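/- **Conventions.** A small category $\Lambda$ is identified with its set of morphisms, objects being identity morphisms; $\alpha\beta$ is defined when $s(\alpha)=r(\beta)$, $v\Lambda=\{\alpha: r(\alpha)=v\}$, and $\Lambda^0$ is the set of objects. Write $\alpha\le\beta$ if $\beta\in\alpha\Lambda$, $[\beta]=\{\alpha:\alpha\le\beta\}$, and $\alpha\Cap\beta$ if $\alpha\Lambda\cap\beta\Lambda\ne\emptyset$. $\Lambda$ is *left cancellative* if $\alpha\beta=\alpha\gamma$ implies $\beta=\gamma$, and *finitely aligned* if every $\alpha\Lambda\cap\beta\Lambda$ is a finite union of sets $\gamma\Lambda$. $\mathsf{FE}(\alpha)$ is the set of finite $F\subseteq r(\alpha)\Lambda$ such that every $\gamma\in\alpha\Lambda$ satisfies $\beta\Cap\gamma$ for some $\beta\in F$. **Tight groupoid.** Let $\Lambda$ be left cancellative and finitely aligned. $\Lambda^*$ is the set of nonempty subsets of $\Lambda$ that are hereditary (closed downwards for $\le$) and upwards directed, and $\Lambda^{**}$ is the set of maximal elements of $\Lambda^*$. $\Lambda_{tight}$ is the set of $C\in\Lambda^*$ such that for all $\alpha\in C$ and all finite $Y\subseteq\Lambda$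 with $C\cap Y=\emptyset$ there is $D\in\Lambda^{**}$ with $\alpha\in D$ and $D\cap Y=\emptyset$; it carries the coarsest topology in which all sets $\{C:\alpha\in C\}$ are clopen. $\mathcal S_\Lambda$ is the inverse semigroup of partial bijections of $\Lambda$ generated by $\tau^\alpha:s(\alpha)\Lambda\to\alpha\Lambda$, $\beta\mapsto\alpha\beta$, and $\sigma^\alpha=(\tau^\alpha)^{-1}$, for $\alpha\in\Lambda$. For $F\in\Lambda_{tight}$ with $F\cap\mathrm{dom}(s)\neq\emptyset$ put $s\cdot F=\bigcup_{\gamma\in F\cap \mathrm{dom}(s)}[s(\gamma)]\in\Lambda_{tight}$. $\mathcal G_{tight}(\Lambda)$ is the groupoid of germs $[s,F]$ of this action ($[s,F]=[t,F]$ iff $se=te$ for some idempotent $e\in\mathcal S_\Lambda$ with $F\cap\mathrm{dom}(e)\ne\emptyset$), with source $F$ and range $s\cdot F$, and with the topology generated by the sets $\{[s,F]:F\in U,\ F\cap\mathrm{dom}(s)\ne\emptyset\}$, $s\in\mathcal S_\Lambda$, $U\subseteq\Lambda_{tight}$ open. It is *topologically free* if the interior of its isotropy bundle $\{x: s(x)=r(x)\}$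 equals its unit space. **Category systems.** Let $\Gamma$ be a submonoid of a group $Q$ with $\Gamma\cap\Gamma^{-1}=\{1\}$. A *length function* is a map $\mathbf d:\Lambda\to\Gamma$ with $\mathbf d(\alpha\beta)=\mathbf d(\alpha)\mathbf d(\beta)$ whenever $s(\alpha)=r(\beta)$. $\mathrm{PIso}(\Lambda,\mathbf d)$ is the groupoid of bijections $f:v\Lambda\to w\Lambda$ ($v,w\in\Lambda^0$) with $f(\alpha\Lambda)=f(\alpha)\Lambda$, $f(v)=w$ and $\mathbf d\circ f=\mathbf d$ on $v\Lambda$. An *action* of a discrete groupoid $\mathcal G$ on $\Lambda$ is a groupoid homomorphism $\mathcal G\to\mathrm{PIso}(\Lambda,\mathbf d)$ that is bijective on unit spaces; identify $\mathcal G^{(0)}=\Lambda^0$ by it, and write $g\cdot\alpha$ for the action of $g$ on $\alpha\in s(g)\Lambda$. A *category cocycle* is a map $\varphi:\{(g,\alpha)\in\mathcal G\times\Lambda:s(g)=r(\alpha)\}\to\mathcal G$ such that, whenever the terms are defined, $s(\varphi(g,\alpha))=s(\alpha)$, $r(\varphi(g,\alpha))=s(g\cdot\alpha)$, $\varphi(gh,\alpha)=\varphi(g,h\cdot\alpha)\varphi(h,\alpha)$,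 $\varphi(g,s(g))=g$, $\varphi(r(\alpha),\alpha)=s(\alpha)$, $\varphi(g,\alpha\beta)=\varphi(\varphi(g,\alpha),\beta)$ and $g\cdot(\alpha\beta)=(g\cdot\alpha)(\varphi(g,\alpha)\cdot\beta)$. Then $(\Lambda,\mathbf d,\mathcal G,\varphi)$ is a *category system*, and its *Zappa–Szép product* $\Lambda\Join^\varphi\mathcal G$ is the small category of pairs $(\alpha,g)\in\Lambda\times\mathcal G$ with $s(\alpha)=r(g)$, with $r(\alpha,g)=r(\alpha)$, $s(\alpha,g)=s(g)$ and $(\alpha,g)(\beta,h)=(\alpha(g\cdot\beta),\varphi(g,\beta)h)$; it is again left cancellative and finitely aligned. **Proposition.** Let $\Lambda$ be a finitely aligned left cancellative small category with length function $\mathbf d:\Lambda\to\Gamma$, let $\mathcal G$ be a discrete groupoid acting on $\Lambda$, and let $(\Lambda,\mathbf d,\mathcal G,\varphi)$ be a category system. If $\mathcal G_{tight}(\Lambda\Join^\varphi\mathcal G)$ is Hausdorff or $\Lambda_{tight}=\Lambda^{**}$, then the following are equivalent: 1. $\mathcal G_{tight}(\Lambda\Join^\varphi\mathcal G)$ is topologically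 free. 2. Given $(\alpha,a),(\beta,b)\in\Lambda\Join^\varphi\mathcal G$ with $r(\alpha,a)=r(\beta,b)$ and $s(\alpha,a)=s(\beta,b)$, if $(\alpha,a)(\delta,d)\Cap(\beta,b)(\delta,d)$ for every $(\delta,d)\in s(\alpha,a)(\Lambda\Join^\varphi\mathcal G)$, then there exists $F\in\mathsf{FE}(s(\alpha,a))$ such that $(\alpha,a)(\gamma,d)=(\beta,b)(\gamma,d)$ for every $(\gamma,d)\in F$. 3. Given $\alpha,\beta\in\Lambda$ and $a,b\in\mathcal G$ with $r(\alpha)=r(\beta)$, $r(a)=s(\alpha)$, $r(b)=s(\beta)$ and $s(a)=s(b)$, if $\alpha(a\cdot\delta)\Cap\beta(b\cdot\delta)$ for every $\delta\in s(a)\Lambda$, then there exists $F\in\mathsf{FE}(s(a))$ such that $\alpha(a\cdot\gamma)=\beta(b\cdot\gamma)$ and $\varphi(a,\gamma)=\varphi(b,\gamma)$ for every $\gamma\in F$. -/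

import Mathlib

open CategoryTheory

-- So that `x ⟶ y` always elaborates to the hom-set of the ambient category structure directly.
attribute [-instance] catToReflQuiver

universe u v w q

namespace LCSC

/-! ### Small categories, written multiplicatively

For a small category `Λ` with object set `C`, the product `αβ` (defined when `s(α) = r(β)`) is the
composite "first `β`, then `α`", that is `β ≫ α` in Mathlib's diagrammatic order. -/

section Category

/-- The set of all morphisms of a category; `src` is `s` and `tgt` is `r`. -/
structure Mor (C : Type u) [Category.{v} C] where
  {src : C}
  {tgt : C}
  hom : src ⟶ tgt

/-- The set `vΛ` of all morphisms with range `v`. -/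
structure Into {C : Type u} [Category.{v} C] (v : C) where
  {src : C}
  hom : src ⟶ v

variable {C : Type u} [Category.{v} C]

/-- The inclusion `vΛ ⊆ Λ`. -/
abbrev Into.toMor {v : C} (α : Into v) : Mor C := ⟨α.hom⟩

/-- The identity at `v`, as an element of `vΛ`. -/
abbrev Into.one (v : C) : Into v := ⟨𝟙 v⟩

/-- The product `αβ ∈ vΛ` for `α ∈ vΛ` and `β ∈ s(α)Λ`. -/
abbrev Into.mul {v : C} (α : Into v) (β : Into α.src) : Into v := ⟨β.hom ≫ α.hom⟩

/-- The product `αβ ∈ Λ` for `α ∈ Λ` and `β ∈ s(α)Λ`. -/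
abbrev Mor.mul (α : Mor C) (β : Into α.src) : Mor C := ⟨β.hom ≫ α.hom⟩

/-- `α ≤ β` when `α` is an initial segment of `β`. -/
instance : LE (Mor C) := ⟨fun α β => ∃ γ : Into α.src, β = α.mul γ⟩

/-- `α ⋒ β`, that is `αΛ ∩ βΛ ≠ ∅`. -/
def Meets (α β : Mor C) : Prop := ∃ ε : Mor C, α ≤ ε ∧ β ≤ ε

/-- `F ∈ FE(α)`: `F` is a finite subset of `r(α)Λ` that is exhaustive with respect to `α`. -/
def IsFE (α : Mor C) (F : Set (Into α.tgt)) : Prop :=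
  F.Finite ∧ ∀ γ : Mor C, α ≤ γ → ∃ β ∈ F, Meets β.toMor γ

variable (C) in
/-- Left cancellation: `αβ = αγ` implies `β = γ`. -/
class LeftCancellative : Prop where
  mono : ∀ {x y : C} (f : x ⟶ y), Mono f

variable (C) in
/-- Finite alignment: `αΛ ∩ βΛ` is always a finite union of sets `γΛ`. -/
class FinitelyAligned : Prop where
  exists_finite : ∀ α β : Mor C, ∃ Γ : Set (Mor C), Γ.Finite ∧
    {ε : Mor C | α ≤ ε ∧ β ≤ ε} = ⋃ γ ∈ Γ, {ε : Mor C | γ ≤ ε}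

theorem Into.toMor_injective {v : C} : Function.Injective (Into.toMor : Into v → Mor C) := by
  rintro ⟨f⟩ ⟨g⟩ h
  simp only [Into.toMor, Mor.mk.injEq] at h
  obtain ⟨rfl, -, h⟩ := h
  cases h
  rfl

theorem Mor.mul_injective [LeftCancellative C] (α : Mor C) : Function.Injective α.mul := by
  obtain ⟨a⟩ := α
  rintro ⟨f⟩ ⟨g⟩ h
  simp only [Mor.mul, Mor.mk.injEq] at h
  obtain ⟨rfl, -, h⟩ := h
  have := LeftCancellative.mono a
  rw [(cancel_mono a).1 (eq_of_heq h)]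

theorem Into.mul_injective [LeftCancellative C] {v : C} (α : Into v) :
    Function.Injective α.mul := by
  intro β γ h
  exact Mor.mul_injective α.toMor (congrArg Into.toMor h)

theorem Into.mul_assoc' {v : C} (α : Into v) (β : Into α.src) (γ : Into β.src) :
    (α.mul β).mul γ = α.mul (β.mul γ) := by
  simp [Into.mul]

theorem le_rfl' (α : Mor C) : α ≤ α := ⟨⟨𝟙 _⟩, by simp [Mor.mul]⟩

theorem le_trans' {α β γ : Mor C} : α ≤ β → β ≤ γ → α ≤ γ := by
  rintro ⟨⟨f⟩, rfl⟩ ⟨⟨g⟩, rfl⟩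
  exact ⟨⟨g ≫ f⟩, congrArg Mor.mk (Category.assoc _ _ _).symm⟩

end Category

/-! ### Hereditary directed sets and the inverse semigroup `S_Λ` -/

section Tight

variable (C : Type u) [Category.{v} C]

/-- `Λ^*`: the nonempty, hereditary, upwards directed subsets of `Λ`. -/
def hdSets : Set (Set (Mor C)) :=
  {F | F.Nonempty ∧ (∀ α β : Mor C, β ∈ F → α ≤ β → α ∈ F) ∧
    ∀ α β : Mor C, α ∈ F → β ∈ F → ∃ γ ∈ F, α ≤ γ ∧ β ≤ γ}

/-- `Λ^{**}`: the maximal elements of `Λ^*`. -/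
def maximalSets : Set (Set (Mor C)) :=
  {F | F ∈ hdSets C ∧ ∀ D ∈ hdSets C, F ⊆ D → D = F}

/-- `Λ_tight`: the tight elements of `Λ^*`. -/
def tightSets : Set (Set (Mor C)) :=
  {F | F ∈ hdSets C ∧ ∀ α ∈ F, ∀ Y : Set (Mor C), Y.Finite → F ∩ Y = ∅ →
    ∃ D ∈ maximalSets C, α ∈ D ∧ D ∩ Y = ∅}

/-- The space `Λ_tight`. -/
structure TightSpace where
  carrier : Set (Mor C)
  isTight : carrier ∈ tightSets C

/-- The topology of `Λ_tight`: the coarsest one for which all sets `{F | α ∈ F}` are clopen. -/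
instance : TopologicalSpace (TightSpace C) :=
  TopologicalSpace.generateFrom
    {U | ∃ α : Mor C, U = {F | α ∈ F.carrier} ∨ U = {F | α ∉ F.carrier}}

variable {C}

theorem TightSpace.hd (F : TightSpace C) : F.carrier ∈ hdSets C := F.isTight.1

open Classical in
/-- The partial bijection `τ^α : s(α)Λ → αΛ`, `β ↦ αβ`. -/
noncomputable def tau [LeftCancellative C] (α : Mor C) : Mor C ≃. Mor C where
  toFun x := if h : ∃ β : Into α.src, x = β.toMor then some (α.mul h.choose) else none
  invFun y := if h : ∃ β : Into α.src, y = α.mul β then some h.choose.toMor else none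
  inv x y := by
    constructor
    · intro hxy
      split_ifs at hxy with h
      · have hc := h.choose_spec
        have hx : x = h.choose.toMor := (Option.some.inj hxy).symm
        have hex : ∃ β : Into α.src, x = β.toMor := ⟨_, hx⟩
        have e : hex.choose = h.choose :=
          Into.toMor_injective (hex.choose_spec.symm.trans hx)
        simp only [hex, dite_true, e, ← hc]
    · intro hxy
      split_ifs at hxy with h
      · have hc := h.choose_spec
        have hy : y = α.mul h.choose := (Option.some.inj hxy).symm
        have hex : ∃ β : Into α.src, y = α.mul β := ⟨_, hy⟩
        have e : hex.choose = h.choose :=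
          Mor.mul_injective α (hex.choose_spec.symm.trans hy)
        simp only [hex, dite_true, e, ← hc]

theorem mem_tau [LeftCancellative C] {α x y : Mor C} :
    y ∈ tau α x ↔ ∃ β : Into α.src, x = β.toMor ∧ y = α.mul β := by
  classical
  constructor
  · intro h
    change (if h : ∃ β : Into α.src, x = β.toMor then some (α.mul h.choose) else none) = some y at h
    split_ifs at h with hx
    exact ⟨_, hx.choose_spec, (Option.some.inj h).symm⟩
  · rintro ⟨β, rfl, rfl⟩
    have hex : ∃ γ : Into α.src, β.toMor = γ.toMor := ⟨_, rfl⟩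
    have e : β = hex.choose := Into.toMor_injective hex.choose_spec
    change (if h : ∃ γ : Into α.src, β.toMor = γ.toMor then some (α.mul h.choose) else none) =
      some (α.mul β)
    rw [dif_pos hex, ← e]

/-- The partial bijection `σ^α : αΛ → s(α)Λ`, `αβ ↦ β`. -/
noncomputable def sigma [LeftCancellative C] (α : Mor C) : Mor C ≃. Mor C := (tau α).symm

/-- Membership in `S_Λ`, the semigroup of partial bijections of `Λ` generated by all `σ^α` and
`τ^α`. The product `st` is the composite `s ∘ t`, that is `t.trans s`. -/
inductive InS [LeftCancellative C] : (Mor C ≃. Mor C) → Prop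
  | tau (α : Mor C) : InS (LCSC.tau α)
  | sigma (α : Mor C) : InS (LCSC.sigma α)
  | mul {s t : Mor C ≃. Mor C} : InS s → InS t → InS (t.trans s)

/-- `F ∩ dom(s) ≠ ∅`. -/
def MeetsDom (s : Mor C ≃. Mor C) (F : Set (Mor C)) : Prop := ∃ x ∈ F, ∃ y, y ∈ s x

/-- `s · F`, the union of the sets `[s(x)]` of initial segments of `s(x)`, over all
`x ∈ F ∩ dom(s)`. -/
def act (s : Mor C ≃. Mor C) (F : Set (Mor C)) : Set (Mor C) :=
  {z | ∃ x ∈ F, ∃ y, y ∈ s x ∧ z ≤ y}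

/-- Idempotent partial bijections. -/
def IsIdem (e : Mor C ≃. Mor C) : Prop := e.trans e = e

/-! #### Facts about `S_Λ` and its action -/

theorem PEquiv_fun {s : Mor C ≃. Mor C} {x y z : Mor C} (h : y ∈ s x) (h' : z ∈ s x) : y = z :=
  Option.mem_unique h h'

theorem IsIdem.eq {e : Mor C ≃. Mor C} (he : IsIdem e) {x y : Mor C} (h : y ∈ e x) : y = x := by
  have h1 : y ∈ (e.trans e) x := by rw [he]; exact h
  obtain ⟨z, hz, hy⟩ := (PEquiv.mem_trans e e x y).1 h1
  obtain rfl := PEquiv_fun h hz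
  exact e.inj hy h

theorem act_mono (s : Mor C ≃. Mor C) {F G : Set (Mor C)} (h : F ⊆ G) : act s F ⊆ act s G := by
  rintro z ⟨x, hx, r⟩
  exact ⟨x, h hx, r⟩

theorem mem_act {s : Mor C ≃. Mor C} {F : Set (Mor C)} {x y : Mor C} (hx : x ∈ F) (h : y ∈ s x) :
    y ∈ act s F := ⟨x, hx, y, h, le_rfl' y⟩

theorem MeetsDom.symm {s : Mor C ≃. Mor C} {F : Set (Mor C)} (hd : MeetsDom s F) :
    MeetsDom s.symm (act s F) := by
  obtain ⟨x, hx, y, hy⟩ := hd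
  exact ⟨y, mem_act hx hy, x, (PEquiv.mem_iff_mem _).2 hy⟩

section LC

variable [LeftCancellative C]

theorem InS.symm {s : Mor C ≃. Mor C} (hs : InS s) : InS s.symm := by
  induction hs with
  | tau α => exact InS.sigma α
  | sigma α => exact InS.tau α
  | mul _ _ h1 h2 => exact InS.mul h2 h1

/-- Elements of `S_Λ` preserve sources and commute with multiplication on the right. -/
theorem InS.equivariant {s : Mor C ≃. Mor C} (hs : InS s) :
    (∀ x y : Mor C, y ∈ s x → x.src = y.src) ∧
    ∀ {a b c d : C} (f : b ⟶ c) (g : b ⟶ d) (k : a ⟶ b),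
      Mor.mk g ∈ s (Mor.mk f) → Mor.mk (k ≫ g) ∈ s (Mor.mk (k ≫ f)) := by
  induction hs with
  | tau α =>
    refine ⟨?_, ?_⟩
    · intro x y h
      obtain ⟨β, rfl, rfl⟩ := mem_tau.1 h
      rfl
    · intro a b c d f g k h
      obtain ⟨⟨β⟩, h1, h2⟩ := mem_tau.1 h
      obtain ⟨al⟩ := α
      simp only [Into.toMor, Mor.mul, Mor.mk.injEq] at h1 h2
      obtain ⟨rfl, rfl, h1⟩ := h1
      obtain ⟨-, rfl, h2⟩ := h2
      cases h1
      cases h2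
      exact mem_tau.2 ⟨⟨k ≫ f⟩, rfl, by simp [Mor.mul]⟩
  | sigma α =>
    refine ⟨?_, ?_⟩
    · intro x y h
      obtain ⟨β, rfl, rfl⟩ := mem_tau.1 ((PEquiv.mem_iff_mem _).1 h)
      rfl
    · intro a b c d f g k h
      refine (PEquiv.mem_iff_mem _).2 ?_
      obtain ⟨⟨β⟩, h1, h2⟩ := mem_tau.1 ((PEquiv.mem_iff_mem _).1 h)
      obtain ⟨al⟩ := α
      simp only [Into.toMor, Mor.mul, Mor.mk.injEq] at h1 h2
      obtain ⟨rfl, rfl, h1⟩ := h1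
      obtain ⟨-, rfl, h2⟩ := h2
      cases h1
      cases h2
      exact mem_tau.2 ⟨⟨k ≫ g⟩, rfl, by simp [Mor.mul]⟩
  | mul hs ht ihs iht =>
    refine ⟨?_, ?_⟩
    · intro x y h
      obtain ⟨z, h1, h2⟩ := (PEquiv.mem_trans _ _ x y).1 h
      exact (iht.1 _ _ h1).trans (ihs.1 _ _ h2)
    · intro a b c d f g k h
      obtain ⟨⟨z⟩, h1, h2⟩ := (PEquiv.mem_trans _ _ _ _).1 h
      obtain rfl : b = _ := iht.1 _ _ h1
      exact (PEquiv.mem_trans _ _ _ _).2 ⟨_, iht.2 _ _ k h1, ihs.2 _ _ k h2⟩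

theorem InS.extend₂ {s t : Mor C ≃. Mor C} (hs : InS s) (ht : InS t) {x y x' : Mor C}
    (h : y ∈ s x) (h' : y ∈ t x) (hx : x ≤ x') : ∃ y', y' ∈ s x' ∧ y' ∈ t x' ∧ y ≤ y' := by
  obtain ⟨f⟩ := x
  obtain ⟨g⟩ := y
  obtain ⟨⟨k⟩, rfl⟩ := hx
  have e := hs.equivariant.1 _ _ h
  dsimp only at e
  subst e
  exact ⟨_, hs.equivariant.2 f g k h, ht.equivariant.2 f g k h', ⟨⟨k⟩, rfl⟩⟩

theorem InS.extend {s : Mor C ≃. Mor C} (hs : InS s) {x y x' : Mor C}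
    (h : y ∈ s x) (hx : x ≤ x') : ∃ y', y' ∈ s x' ∧ y ≤ y' := by
  obtain ⟨y', h1, -, h2⟩ := hs.extend₂ hs h h hx
  exact ⟨y', h1, h2⟩

theorem InS.extend_le {s : Mor C ≃. Mor C} (hs : InS s) {x y x' y' : Mor C}
    (h : y ∈ s x) (h' : y' ∈ s x') (hx : x ≤ x') : y ≤ y' := by
  obtain ⟨z, h1, h2⟩ := hs.extend h hx
  rwa [PEquiv_fun h' h1]

theorem act_hd {s : Mor C ≃. Mor C} (hs : InS s) {F : Set (Mor C)} (hF : F ∈ hdSets C)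
    (hd : MeetsDom s F) : act s F ∈ hdSets C := by
  obtain ⟨x, hx, y, hy⟩ := hd
  refine ⟨⟨y, mem_act hx hy⟩, ?_, ?_⟩
  · rintro α β ⟨x, hx, y, hy, hz⟩ hle
    exact ⟨x, hx, y, hy, le_trans' hle hz⟩
  · rintro α β ⟨x, hx, y, hy, hz⟩ ⟨x', hx', y', hy', hz'⟩
    obtain ⟨x'', hx'', h1, h2⟩ := hF.2.2 x x' hx hx'
    obtain ⟨y'', hy'', h3⟩ := hs.extend hy h1
    exact ⟨y'', mem_act hx'' hy'', le_trans' hz h3,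
      le_trans' hz' (hs.extend_le hy' hy'' h2)⟩

theorem act_symm_act {s : Mor C ≃. Mor C} (hs : InS s) {F : Set (Mor C)} (hF : F ∈ hdSets C)
    (hd : MeetsDom s F) : act s.symm (act s F) = F := by
  apply Set.Subset.antisymm
  · rintro z ⟨y, ⟨x', hx', y', hy', hle⟩, x, hx, hz⟩
    have h1 : x ≤ x' := hs.symm.extend_le hx ((PEquiv.mem_iff_mem _).2 hy') hle
    exact hF.2.1 z x' hx' (le_trans' hz h1)
  · intro z hz
    obtain ⟨x, hx, y, hy⟩ := hd
    obtain ⟨x', hx', h1, h2⟩ := hF.2.2 z x hz hx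
    obtain ⟨y', hy', -⟩ := hs.extend hy h2
    exact ⟨y', mem_act hx' hy', x', (PEquiv.mem_iff_mem _).2 hy', h1⟩

theorem act_maximal {s : Mor C ≃. Mor C} (hs : InS s) {F : Set (Mor C)} (hF : F ∈ maximalSets C)
    (hd : MeetsDom s F) : act s F ∈ maximalSets C := by
  refine ⟨act_hd hs hF.1 hd, fun D hD hle => ?_⟩
  have hd' : MeetsDom s.symm D := by
    obtain ⟨y, hy, x, hx⟩ := hd.symm
    exact ⟨y, hle hy, x, hx⟩
  have h1 : F ⊆ act s.symm D := by
    rw [← act_symm_act hs hF.1 hd]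
    exact act_mono _ hle
  have h2 := hF.2 _ (act_hd hs.symm hD hd') h1
  rw [← h2]
  exact (act_symm_act hs.symm hD hd').symm

theorem act_tight [FinitelyAligned C] {s : Mor C ≃. Mor C} (hs : InS s) {F : Set (Mor C)}
    (hF : F ∈ tightSets C) (hd : MeetsDom s F) : act s F ∈ tightSets C := by
  have hhd := act_hd hs hF.1 hd
  refine ⟨hhd, ?_⟩
  rintro α ⟨x, hx, y, hy, hα⟩ Y hY hdis
  choose Γ hΓ hΓe using fun z : Mor C => FinitelyAligned.exists_finite z y
  set Z : Set (Mor C) := ⋃ z ∈ Y, Γ z with hZ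
  have hZf : Z.Finite := hY.biUnion fun z _ => hΓ z
  set X : Set (Mor C) := {p | ∃ ζ ∈ Z, p ∈ s.symm ζ} with hX
  have hXf : X.Finite := by
    have : X ⊆ ⋃ ζ ∈ Z, {p | p ∈ s.symm ζ} := by
      rintro p ⟨ζ, h1, h2⟩
      exact Set.mem_biUnion h1 h2
    refine (hZf.biUnion fun ζ _ => ?_).subset this
    exact Set.Subsingleton.finite fun a ha b hb => PEquiv_fun ha hb
  have hge : ∀ z ζ, ζ ∈ Γ z → z ≤ ζ ∧ y ≤ ζ := by
    intro z ζ h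
    have : ζ ∈ {ε : Mor C | z ≤ ε ∧ y ≤ ε} := by
      rw [hΓe z]
      exact Set.mem_biUnion h (le_rfl' ζ)
    exact this
  have hFX : F ∩ X = ∅ := by
    ext p
    simp only [Set.mem_inter_iff, Set.mem_empty_iff_false, iff_false, not_and]
    rintro hp ⟨ζ, hζ, hpζ⟩
    obtain ⟨z, hz, hζz⟩ := Set.mem_iUnion₂.1 hζ
    have h1 : z ∈ act s F := ⟨p, hp, ζ, (PEquiv.mem_iff_mem _).1 hpζ, (hge z ζ hζz).1⟩
    have : z ∈ act s F ∩ Y := ⟨h1, hz⟩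
    rw [hdis] at this
    exact this
  obtain ⟨D, hD, hxD, hDX⟩ := hF.2 x hx X hXf hFX
  have hdD : MeetsDom s D := ⟨x, hxD, y, hy⟩
  have hyD : y ∈ act s D := mem_act hxD hy
  have hDhd := act_hd hs hD.1 hdD
  refine ⟨act s D, act_maximal hs hD hdD, hDhd.2.1 α y hyD hα, ?_⟩
  ext z
  simp only [Set.mem_inter_iff, Set.mem_empty_iff_false, iff_false, not_and]
  intro hzD hzY
  obtain ⟨ε, hε, h1, h2⟩ := hDhd.2.2 z y hzD hyD
  have h3 : ε ∈ {ε : Mor C | z ≤ ε ∧ y ≤ ε} := ⟨h1, h2⟩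
  rw [hΓe z] at h3
  obtain ⟨ζ, hζ, hle⟩ := Set.mem_iUnion₂.1 h3
  have hζD : ζ ∈ act s D := hDhd.2.1 ζ ε hε hle
  obtain ⟨p, hp, -⟩ := hs.symm.extend ((PEquiv.mem_iff_mem _).2 hy) (hge z ζ hζ).2
  have hpD : p ∈ D := by
    rw [← act_symm_act hs hD.1 hdD]
    exact mem_act hζD hp
  have : p ∈ D ∩ X := ⟨hpD, ζ, Set.mem_biUnion hzY hζ, hp⟩
  rw [hDX] at this
  exact this

theorem act_idem {e : Mor C ≃. Mor C} (he : InS e) (hi : IsIdem e) {F : Set (Mor C)}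
    (hF : F ∈ hdSets C) (hd : MeetsDom e F) : act e F = F := by
  apply Set.Subset.antisymm
  · rintro z ⟨x, hx, y, hy, hz⟩
    rw [hi.eq hy] at hz
    exact hF.2.1 z x hx hz
  · intro z hz
    obtain ⟨x, hx, y, hy⟩ := hd
    obtain ⟨x', hx', h1, h2⟩ := hF.2.2 z x hz hx
    obtain ⟨y', hy', -⟩ := he.extend hy h2
    refine ⟨x', hx', y', hy', ?_⟩
    rwa [hi.eq hy']

theorem meetsDom_trans {s t : Mor C ≃. Mor C} {F : Set (Mor C)} (ht : InS t) (hd' : MeetsDom t (act s F)) :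
    MeetsDom (s.trans t) F := by
  obtain ⟨y, ⟨x', hx', y', hy', hle⟩, z, hz⟩ := hd'
  obtain ⟨z', hz', -⟩ := ht.extend hz hle
  exact ⟨x', hx', z', (PEquiv.mem_trans _ _ _ _).2 ⟨y', hy', hz'⟩⟩

theorem act_trans {s t : Mor C ≃. Mor C} (ht : InS t) (F : Set (Mor C)) :
    act (s.trans t) F = act t (act s F) := by
  apply Set.Subset.antisymm
  · rintro z ⟨x, hx, y, hy, hz⟩
    obtain ⟨p, h1, h2⟩ := (PEquiv.mem_trans _ _ _ _).1 hy
    exact ⟨p, mem_act hx h1, y, h2, hz⟩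
  · rintro z ⟨y, ⟨x', hx', y', hy', hle⟩, p, hp, hz⟩
    obtain ⟨p', hp', h⟩ := ht.extend hp hle
    exact ⟨x', hx', p', (PEquiv.mem_trans _ _ _ _).2 ⟨y', hy', hp'⟩, le_trans' hz h⟩

/-- The idempotent `τ^α σ^α`, the identity of `αΛ`. -/
noncomputable def idemAt (α : Mor C) : Mor C ≃. Mor C := (sigma α).trans (tau α)

theorem mem_idemAt {α x y : Mor C} : y ∈ idemAt α x ↔ y = x ∧ α ≤ x := by
  constructor
  · intro h
    obtain ⟨z, h1, h2⟩ := (PEquiv.mem_trans _ _ _ _).1 h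
    have h1' : x ∈ tau α z := (PEquiv.mem_iff_mem _).1 h1
    obtain ⟨β, rfl, hx⟩ := mem_tau.1 h1'
    exact ⟨PEquiv_fun h2 h1', β, hx⟩
  · rintro ⟨rfl, β, rfl⟩
    have : α.mul β ∈ tau α β.toMor := mem_tau.2 ⟨β, rfl, rfl⟩
    exact (PEquiv.mem_trans _ _ _ _).2 ⟨_, (PEquiv.mem_iff_mem _).2 this, this⟩

theorem inS_idemAt (α : Mor C) : InS (idemAt α) := InS.mul (InS.tau α) (InS.sigma α)

theorem isIdem_idemAt (α : Mor C) : IsIdem (idemAt α) := by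
  unfold IsIdem
  ext x y
  change y ∈ (idemAt α).trans (idemAt α) x ↔ y ∈ idemAt α x
  rw [PEquiv.mem_trans]
  constructor
  · rintro ⟨z, h1, h2⟩
    obtain rfl := (mem_idemAt.1 h1).1
    exact h2
  · intro h
    obtain ⟨rfl, h'⟩ := mem_idemAt.1 h
    exact ⟨_, h, h⟩

theorem meetsDom_idemAt {α : Mor C} {F : Set (Mor C)} (h : α ∈ F) : MeetsDom (idemAt α) F :=
  ⟨α, h, α, mem_idemAt.2 ⟨rfl, le_rfl' α⟩⟩

/-- `(s, F) ∼ (t, F)`: there is an idempotent `e ∈ S_Λ` with `F ∩ dom(e) ≠ ∅` and `se = te`. -/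
def SameGerm (F : Set (Mor C)) (s t : Mor C ≃. Mor C) : Prop :=
  ∃ e : Mor C ≃. Mor C, InS e ∧ IsIdem e ∧ MeetsDom e F ∧ e.trans s = e.trans t

theorem sameGerm_iff {F : Set (Mor C)} (hF : F ∈ hdSets C) {s t : Mor C ≃. Mor C}
    (hs : InS s) (ht : InS t) (hd : MeetsDom s F) :
    SameGerm F s t ↔ ∃ x ∈ F, ∃ y, y ∈ s x ∧ y ∈ t x := by
  constructor
  · rintro ⟨e, he, hi, ⟨x, hx, y, hy⟩, h⟩
    obtain ⟨x', hx', y', hy'⟩ := hd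
    obtain ⟨x'', hx'', h1, h2⟩ := hF.2.2 x x' hx hx'
    obtain ⟨z, hz, -⟩ := he.extend hy h1
    obtain ⟨p, hp, -⟩ := hs.extend hy' h2
    obtain rfl := hi.eq hz
    have h3 : p ∈ (e.trans s) z := (PEquiv.mem_trans _ _ _ _).2 ⟨_, hz, hp⟩
    rw [h] at h3
    obtain ⟨q, hq, hq'⟩ := (PEquiv.mem_trans _ _ _ _).1 h3
    obtain rfl := hi.eq hq
    exact ⟨_, hx'', p, hp, hq'⟩
  · rintro ⟨x, hx, y, h1, h2⟩
    refine ⟨idemAt x, inS_idemAt x, isIdem_idemAt x, meetsDom_idemAt hx, ?_⟩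
    ext p z
    change z ∈ (idemAt x).trans s p ↔ z ∈ (idemAt x).trans t p
    rw [PEquiv.mem_trans, PEquiv.mem_trans]
    constructor
    · rintro ⟨p', hp, hz⟩
      obtain ⟨rfl, hle⟩ := mem_idemAt.1 hp
      obtain ⟨y', h3, h4, -⟩ := hs.extend₂ ht h1 h2 hle
      obtain rfl := PEquiv_fun hz h3
      exact ⟨_, hp, h4⟩
    · rintro ⟨p', hp, hz⟩
      obtain ⟨rfl, hle⟩ := mem_idemAt.1 hp
      obtain ⟨y', h3, h4, -⟩ := hs.extend₂ ht h1 h2 hle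
      obtain rfl := PEquiv_fun hz h4
      exact ⟨_, hp, h3⟩

/-! ### The tight groupoid -/

/-- The pairs `(s, F)` with `s ∈ S_Λ`, `F ∩ dom(s) ≠ ∅` and `s · F = G`. -/
structure GermRep (F G : TightSpace C) where
  elt : Mor C ≃. Mor C
  inS : InS elt
  dom : MeetsDom elt F.carrier
  act_eq : act elt F.carrier = G.carrier

theorem GermRep.rel_iff {F G : TightSpace C} (s t : GermRep F G) :
    SameGerm F.carrier s.elt t.elt ↔ ∃ x ∈ F.carrier, ∃ y, y ∈ s.elt x ∧ y ∈ t.elt x :=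
  sameGerm_iff F.hd s.inS t.inS s.dom

instance germSetoid (F G : TightSpace C) : Setoid (GermRep F G) where
  r s t := SameGerm F.carrier s.elt t.elt
  iseqv :=
    { refl := fun s => by
        rw [GermRep.rel_iff]
        obtain ⟨x, hx, y, hy⟩ := s.dom
        exact ⟨x, hx, y, hy, hy⟩
      symm := fun {s t} h => by
        rw [GermRep.rel_iff] at h ⊢
        obtain ⟨x, hx, y, hy, hy'⟩ := h
        exact ⟨x, hx, y, hy', hy⟩
      trans := fun {s t r} h h' => by
        rw [GermRep.rel_iff] at h h' ⊢
        obtain ⟨x, hx, y, hy, hy'⟩ := h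
        obtain ⟨x', hx', z, hz, hz'⟩ := h'
        obtain ⟨x'', hx'', h1, h2⟩ := F.hd.2.2 x x' hx hx'
        obtain ⟨p, hp, hp', -⟩ := s.inS.extend₂ t.inS hy hy' h1
        obtain ⟨q, hq, hq', -⟩ := t.inS.extend₂ r.inS hz hz' h2
        obtain rfl := PEquiv_fun hp' hq
        exact ⟨x'', hx'', p, hp, hq'⟩ }

theorem GermRep.equiv_iff {F G : TightSpace C} (s t : GermRep F G) :
    s ≈ t ↔ ∃ x ∈ F.carrier, ∃ y, y ∈ s.elt x ∧ y ∈ t.elt x := GermRep.rel_iff s t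

/-- The unit at `F`, represented by any idempotent `e ∈ S_Λ` with `F ∩ dom(e) ≠ ∅`. -/
noncomputable def GermRep.one (F : TightSpace C) : GermRep F F where
  elt := idemAt F.hd.1.choose
  inS := inS_idemAt _
  dom := meetsDom_idemAt F.hd.1.choose_spec
  act_eq := act_idem (inS_idemAt _) (isIdem_idemAt _) F.hd (meetsDom_idemAt F.hd.1.choose_spec)

/-- `(t, s · F)(s, F) = (ts, F)`. -/
def GermRep.comp {F G H : TightSpace C} (s : GermRep F G) (t : GermRep G H) : GermRep F H where
  elt := s.elt.trans t.elt
  inS := InS.mul t.inS s.inS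
  dom := meetsDom_trans t.inS (by rw [s.act_eq]; exact t.dom)
  act_eq := by rw [act_trans t.inS, s.act_eq, t.act_eq]

/-- `(s, F)⁻¹ = (s^*, s · F)`. -/
def GermRep.inv {F G : TightSpace C} (s : GermRep F G) : GermRep G F where
  elt := s.elt.symm
  inS := s.inS.symm
  dom := by rw [← s.act_eq]; exact s.dom.symm
  act_eq := by rw [← s.act_eq]; exact act_symm_act s.inS F.hd s.dom

theorem GermRep.comp_equiv {F G H : TightSpace C} {s s' : GermRep F G} {t t' : GermRep G H}
    (h : s ≈ s') (h' : t ≈ t') : s.comp t ≈ s'.comp t' := by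
  rw [GermRep.equiv_iff] at h h' ⊢
  obtain ⟨x, hx, y, hy, hy'⟩ := h
  obtain ⟨p, hp, r, hr, hr'⟩ := h'
  rw [← s.act_eq] at hp
  obtain ⟨x1, hx1, y1, hy1, hle⟩ := hp
  obtain ⟨x2, hx2, h1, h2⟩ := F.hd.2.2 x x1 hx hx1
  obtain ⟨y2, hy2, hy2', -⟩ := s.inS.extend₂ s'.inS hy hy' h1
  have h3 : p ≤ y2 := le_trans' hle (s.inS.extend_le hy1 hy2 h2)
  obtain ⟨r2, hr2, hr2', -⟩ := t.inS.extend₂ t'.inS hr hr' h3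
  exact ⟨x2, hx2, r2, (PEquiv.mem_trans _ _ _ _).2 ⟨y2, hy2, hr2⟩,
    (PEquiv.mem_trans _ _ _ _).2 ⟨y2, hy2', hr2'⟩⟩

theorem GermRep.inv_equiv {F G : TightSpace C} {s s' : GermRep F G} (h : s ≈ s') :
    s.inv ≈ s'.inv := by
  rw [GermRep.equiv_iff] at h ⊢
  obtain ⟨x, hx, y, hy, hy'⟩ := h
  refine ⟨y, ?_, x, (PEquiv.mem_iff_mem _).2 hy, (PEquiv.mem_iff_mem _).2 hy'⟩
  rw [← s.act_eq]
  exact mem_act hx hy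

theorem GermRep.one_elt {F : TightSpace C} {x : Mor C} (hx : x ∈ F.carrier) :
    ∃ x' ∈ F.carrier, x ≤ x' ∧ x' ∈ (GermRep.one F).elt x' := by
  obtain ⟨x', hx', h1, h2⟩ := F.hd.2.2 x _ hx F.hd.1.choose_spec
  exact ⟨x', hx', h1, mem_idemAt.2 ⟨rfl, h2⟩⟩

/-- The tight groupoid of `Λ`, as a groupoid with object set `Λ_tight`: the morphisms `F ⟶ G` are
the germs `[s, F]` with `s · F = G`. -/
noncomputable instance : Groupoid (TightSpace C) where
  Hom F G := Quotient (germSetoid F G)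
  id F := Quotient.mk _ (GermRep.one F)
  comp := Quotient.map₂ GermRep.comp fun _ _ h _ _ h' => GermRep.comp_equiv h h'
  inv := Quotient.map GermRep.inv fun _ _ h => GermRep.inv_equiv h
  id_comp {F G} f := by
    induction f using Quotient.inductionOn with | _ s
    refine Quotient.sound ((GermRep.equiv_iff _ _).2 ?_)
    obtain ⟨x, hx, y, hy⟩ := s.dom
    obtain ⟨x', hx', h1, h2⟩ := GermRep.one_elt hx
    obtain ⟨y', hy', -⟩ := s.inS.extend hy h1
    exact ⟨x', hx', y', (PEquiv.mem_trans _ _ _ _).2 ⟨x', h2, hy'⟩, hy'⟩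
  comp_id {F G} f := by
    induction f using Quotient.inductionOn with | _ s
    refine Quotient.sound ((GermRep.equiv_iff _ _).2 ?_)
    obtain ⟨y, hy, x, hx⟩ := s.inv.dom
    obtain ⟨y', hy', h1, h2⟩ := GermRep.one_elt hy
    obtain ⟨x', hx', -⟩ := s.inS.symm.extend hx h1
    have h3 : y' ∈ s.elt x' := (PEquiv.mem_iff_mem _).1 hx'
    refine ⟨x', ?_, y', (PEquiv.mem_trans _ _ _ _).2 ⟨y', h3, h2⟩, h3⟩
    rw [← s.inv.act_eq]
    exact mem_act hy' hx'
  assoc {F G H K} f g h := by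
    induction f using Quotient.inductionOn with | _ s
    induction g using Quotient.inductionOn with | _ t
    induction h using Quotient.inductionOn with | _ r
    refine Quotient.sound ((GermRep.equiv_iff _ _).2 ?_)
    obtain ⟨x, hx, y, hy⟩ := ((s.comp t).comp r).dom
    refine ⟨x, hx, y, hy, ?_⟩
    have e : ((s.comp t).comp r).elt = (s.comp (t.comp r)).elt := PEquiv.trans_assoc _ _ _
    rw [← e]
    exact hy
  inv_comp {F G} f := by
    induction f using Quotient.inductionOn with | _ s
    refine Quotient.sound ((GermRep.equiv_iff _ _).2 ?_)
    obtain ⟨y, hy, x, hx⟩ := s.inv.dom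
    obtain ⟨y', hy', h1, h2⟩ := GermRep.one_elt hy
    obtain ⟨x', hx', -⟩ := s.inS.symm.extend hx h1
    exact ⟨y', hy', y', (PEquiv.mem_trans _ _ _ _).2 ⟨x', hx', (PEquiv.mem_iff_mem _).1 hx'⟩, h2⟩
  comp_inv {F G} f := by
    induction f using Quotient.inductionOn with | _ s
    refine Quotient.sound ((GermRep.equiv_iff _ _).2 ?_)
    obtain ⟨x, hx, y, hy⟩ := s.dom
    obtain ⟨x', hx', h1, h2⟩ := GermRep.one_elt hx
    obtain ⟨y', hy', -⟩ := s.inS.extend hy h1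
    exact ⟨x', hx', x', (PEquiv.mem_trans _ _ _ _).2 ⟨y', hy', (PEquiv.mem_iff_mem _).2 hy'⟩, h2⟩

variable (C) in
/-- The set of elements (arrows) of the tight groupoid `G_tight(Λ)`. -/
abbrev TightGroupoid := Mor (TightSpace C)

/-- The basic open set `Θ(s, U) = {[s, F] | F ∈ U, F ∩ dom(s) ≠ ∅}`. -/
def Theta (s : Mor C ≃. Mor C) (U : Set (TightSpace C)) : Set (TightGroupoid C) :=
  {x | ∃ (F G : TightSpace C) (p : GermRep F G), F ∈ U ∧ p.elt = s ∧
    x = ⟨(Quotient.mk (germSetoid F G) p : F ⟶ G)⟩}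

/-- The topology of the tight groupoid. -/
instance : TopologicalSpace (TightGroupoid C) :=
  TopologicalSpace.generateFrom
    {V | ∃ (s : Mor C ≃. Mor C) (U : Set (TightSpace C)), InS s ∧ IsOpen U ∧ V = Theta s U}

variable (C) in
/-- `G_tight(Λ)` is topologically free: the interior of its isotropy bundle is its unit space. -/
def TightTopologicallyFree : Prop :=
  interior {x : TightGroupoid C | x.src = x.tgt} = Set.range fun F : TightSpace C => ⟨𝟙 F⟩

end LC

end Tight

/-! ### Length functions, partial isomorphisms and groupoid actions -/

section System

/-- A length function on `Λ` with values in a submonoid `Γ` of a group `Q`. -/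
structure LengthFunction (C : Type u) [Category.{v} C] {Q : Type q} [Group Q]
    (Γ : Submonoid Q) where
  toFun : Mor C → Γ
  map_mul : ∀ (α : Mor C) (β : Into α.src), toFun (α.mul β) = toFun α * toFun β.toMor

/-- The objects of a groupoid `𝒢` whose unit space is identified with the object set `C` of `Λ`.
(A copy of `C`, so that both category structures can be used side by side.) -/
structure GObj (C : Type u) where
  obj : C

variable {C : Type u} [Category.{v} C] {Q : Type q} [Group Q] {Γ : Submonoid Q}

/-- The partial isomorphisms `f : vΛ → wΛ`, elements of `PIso(Λ, d)`. -/
structure PIso (d : LengthFunction C Γ) (v w : C) where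
  toEquiv : Into v ≃ Into w
  image_ideal : ∀ α : Into v, toEquiv '' Set.range α.mul = Set.range (toEquiv α).mul
  map_one : toEquiv (Into.one v) = Into.one w
  length_eq : ∀ α : Into v, d.toFun (toEquiv α).toMor = d.toFun α.toMor

/-- An action of the (discrete) groupoid `𝒢` on `Λ`: a groupoid homomorphism from `𝒢` to
`PIso(Λ, d)` that is the identity on units under the identification of the unit spaces. -/
structure GroupoidAction [Groupoid.{w} (GObj C)] (d : LengthFunction C Γ) where
  toPIso : ∀ {v w : C}, ((⟨v⟩ : GObj C) ⟶ ⟨w⟩) → PIso d v w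
  map_id : ∀ (v : C) (α : Into v), (toPIso (𝟙 (⟨v⟩ : GObj C))).toEquiv α = α
  map_comp : ∀ {u v w : C} (h : (⟨u⟩ : GObj C) ⟶ ⟨v⟩) (g : (⟨v⟩ : GObj C) ⟶ ⟨w⟩) (α : Into u),
    (toPIso (h ≫ g)).toEquiv α = (toPIso g).toEquiv ((toPIso h).toEquiv α)

/-- `g · α` for `g ∈ 𝒢` and `α ∈ s(g)Λ`. -/
def GroupoidAction.smul [Groupoid.{w} (GObj C)] {d : LengthFunction C Γ} (A : GroupoidAction d)
    {v w : C} (g : (⟨v⟩ : GObj C) ⟶ ⟨w⟩) (α : Into v) : Into w := (A.toPIso g).toEquiv α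

/-- The set of elements of `𝒢` with source `u`. Equality of two elements of `𝒢` with source `u` is
equality in this set (it includes the equality of their ranges). -/
structure OutOf [Groupoid.{w} (GObj C)] (u : C) where
  {tgt : C}
  hom : (⟨u⟩ : GObj C) ⟶ ⟨tgt⟩

/-- A category system `(Λ, d, 𝒢, φ)`: an action of `𝒢` on `Λ` with a category cocycle `φ`. The
typing of `φ(g, α)` says `s(φ(g, α)) = s(α)` and `r(φ(g, α)) = s(g · α)`. -/
structure CategorySystem [Groupoid.{w} (GObj C)] (d : LengthFunction C Γ) extends
    GroupoidAction d where
  φ : ∀ {v w : C} (g : (⟨v⟩ : GObj C) ⟶ ⟨w⟩) (α : Into v),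
    (⟨α.src⟩ : GObj C) ⟶ ⟨(toGroupoidAction.smul g α).src⟩
  φ_comp : ∀ {u v w : C} (h : (⟨u⟩ : GObj C) ⟶ ⟨v⟩) (g : (⟨v⟩ : GObj C) ⟶ ⟨w⟩) (α : Into u),
    (⟨φ (h ≫ g) α⟩ : OutOf α.src) = ⟨φ h α ≫ φ g (toGroupoidAction.smul h α)⟩
  φ_one : ∀ {v w : C} (g : (⟨v⟩ : GObj C) ⟶ ⟨w⟩), (⟨φ g (Into.one v)⟩ : OutOf v) = ⟨g⟩
  φ_id : ∀ {v : C} (α : Into v),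
    (⟨φ (𝟙 (⟨v⟩ : GObj C)) α⟩ : OutOf α.src) = ⟨𝟙 (⟨α.src⟩ : GObj C)⟩
  φ_mul : ∀ {v w : C} (g : (⟨v⟩ : GObj C) ⟶ ⟨w⟩) (α : Into v) (β : Into α.src),
    (⟨φ g (α.mul β)⟩ : OutOf β.src) = ⟨φ (φ g α) β⟩
  smul_mul : ∀ {v w : C} (g : (⟨v⟩ : GObj C) ⟶ ⟨w⟩) (α : Into v) (β : Into α.src),
    toGroupoidAction.smul g (α.mul β) =
      (toGroupoidAction.smul g α).mul (toGroupoidAction.smul (φ g α) β)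

/-! ### The Zappa-Szép product -/

variable [Groupoid.{w} (GObj C)] {d : LengthFunction C Γ}

/-- The objects of the Zappa-Szép product `Λ ⋈^φ 𝒢`. -/
structure ZappaSzep (S : CategorySystem d) where
  obj : C

/-- The elements `(α, g)` of `Λ ⋈^φ 𝒢`, where `s(α) = r(g)`, with source `s(g)` and range `r(α)`. -/
structure ZSHom (S : CategorySystem d) (x y : ZappaSzep S) where
  {mid : C}
  left : mid ⟶ y.obj
  right : (⟨x.obj⟩ : GObj C) ⟶ ⟨mid⟩

variable {S : CategorySystem d}

theorem ZSHom.ext' {x y : ZappaSzep S} {f g : ZSHom S x y}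
    (h : (⟨f.left⟩ : Into y.obj) = ⟨g.left⟩) (h' : (⟨f.right⟩ : OutOf x.obj) = ⟨g.right⟩) :
    f = g := by
  obtain ⟨a, b⟩ := f
  obtain ⟨a', b'⟩ := g
  simp only [Into.mk.injEq] at h
  obtain ⟨rfl, h⟩ := h
  cases h
  simp only [OutOf.mk.injEq, heq_eq_eq, true_and] at h'
  rw [h']

/-- `(α, g)(β, h) = (α(g · β), φ(g, β)h)`. -/
def ZSHom.mul {x y z : ZappaSzep S} (p : ZSHom S y z) (q : ZSHom S x y) : ZSHom S x z where
  left := (S.smul p.right ⟨q.left⟩).hom ≫ p.left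
  right := q.right ≫ S.φ p.right ⟨q.left⟩

/-- Precomposition with an element of `𝒢`, on elements with a given source. -/
def OutOf.pre {u t : C} (k : (⟨u⟩ : GObj C) ⟶ ⟨t⟩) (f : OutOf t) : OutOf u := ⟨k ≫ f.hom⟩

theorem CategorySystem.smul_id (S : CategorySystem d) {v : C} (α : Into v) :
    S.smul (𝟙 (⟨v⟩ : GObj C)) α = α := S.map_id v α

theorem CategorySystem.smul_comp (S : CategorySystem d) {u v w : C} (h : (⟨u⟩ : GObj C) ⟶ ⟨v⟩)
    (g : (⟨v⟩ : GObj C) ⟶ ⟨w⟩) (α : Into u) : S.smul (h ≫ g) α = S.smul g (S.smul h α) :=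
  S.map_comp h g α

instance : Category (ZappaSzep S) where
  Hom x y := ZSHom S x y
  id x := ⟨𝟙 x.obj, 𝟙 _⟩
  comp q p := ZSHom.mul p q
  id_comp {x y} p := by
    refine ZSHom.ext' ?_ ?_
    · change (⟨p.left⟩ : Into y.obj).mul (S.smul p.right (Into.one x.obj)) = ⟨p.left⟩
      rw [show S.smul p.right (Into.one x.obj) = Into.one _ from (S.toPIso p.right).map_one]
      simp [Into.mul, Into.one]
    · change (⟨𝟙 _ ≫ S.φ p.right (Into.one x.obj)⟩ : OutOf x.obj) = ⟨p.right⟩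
      rw [Category.id_comp]
      exact S.φ_one p.right
  comp_id {x y} q := by
    refine ZSHom.ext' ?_ ?_
    · change (⟨(S.smul (𝟙 _) ⟨q.left⟩).hom ≫ 𝟙 y.obj⟩ : Into y.obj) = ⟨q.left⟩
      rw [Category.comp_id]
      exact S.smul_id ⟨q.left⟩
    · change OutOf.pre q.right ⟨S.φ (𝟙 _) ⟨q.left⟩⟩ = ⟨q.right⟩
      rw [S.φ_id]
      simp [OutOf.pre]
  assoc {x y z t} r q p := by
    refine ZSHom.ext' ?_ ?_
    · change (⟨p.left⟩ : Into t.obj).mul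
          (S.smul p.right ((⟨q.left⟩ : Into z.obj).mul (S.smul q.right ⟨r.left⟩))) =
        ((⟨p.left⟩ : Into t.obj).mul (S.smul p.right ⟨q.left⟩)).mul
          (S.smul (q.right ≫ S.φ p.right ⟨q.left⟩) ⟨r.left⟩)
      rw [S.smul_mul, S.smul_comp, Into.mul_assoc']
    · change OutOf.pre (r.right ≫ S.φ q.right ⟨r.left⟩)
          ⟨S.φ p.right ((⟨q.left⟩ : Into z.obj).mul (S.smul q.right ⟨r.left⟩))⟩ =
        OutOf.pre r.right ⟨S.φ (q.right ≫ S.φ p.right ⟨q.left⟩) ⟨r.left⟩⟩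
      rw [S.φ_mul, S.φ_comp]
      simp [OutOf.pre]

theorem CategorySystem.smul_injective (S : CategorySystem d) {v w : C}
    (g : (⟨v⟩ : GObj C) ⟶ ⟨w⟩) : Function.Injective (S.smul g) := (S.toPIso g).toEquiv.injective

instance [LeftCancellative C] : LeftCancellative (ZappaSzep S) where
  mono {y z} p := by
    constructor
    intro x q q' h
    have h1 : (⟨p.left⟩ : Into z.obj).mul (S.smul p.right ⟨q.left⟩) =
        (⟨p.left⟩ : Into z.obj).mul (S.smul p.right ⟨q'.left⟩) :=
      congrArg (fun k : ZSHom S x z => (⟨k.left⟩ : Into z.obj)) h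
    have h2 := S.smul_injective _ (Into.mul_injective _ h1)
    have h3 : (⟨q.right ≫ S.φ p.right ⟨q.left⟩⟩ : OutOf x.obj) =
        ⟨q'.right ≫ S.φ p.right ⟨q'.left⟩⟩ :=
      congrArg (fun k : ZSHom S x z => (⟨k.right⟩ : OutOf x.obj)) h
    clear h h1
    obtain ⟨a, b⟩ := q
    obtain ⟨a', b'⟩ := q'
    simp only [Into.mk.injEq] at h2
    obtain ⟨rfl, h2⟩ := h2
    cases h2
    simp only [OutOf.mk.injEq, heq_eq_eq, true_and] at h3
    rw [(cancel_mono _).1 h3]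

/-- The first component of an element of `Λ ⋈^φ 𝒢`. -/
def ZSHom.fst (p : Mor (ZappaSzep S)) : Mor C := ⟨(ZSHom.left p.hom : _ ⟶ p.tgt.obj)⟩

theorem ZSHom.le_iff (p q : Mor (ZappaSzep S)) : p ≤ q ↔ ZSHom.fst p ≤ ZSHom.fst q := by
  constructor
  · rintro ⟨γ, rfl⟩
    exact ⟨S.smul (ZSHom.right p.hom) ⟨ZSHom.left γ.hom⟩, rfl⟩
  · obtain ⟨p⟩ := p
    rename_i x y
    obtain ⟨α, g⟩ := p
    obtain ⟨q⟩ := q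
    rename_i m x' y'
    obtain ⟨β, f⟩ := q
    rename_i n
    rintro ⟨⟨γ⟩, h⟩
    simp only [ZSHom.fst, Mor.mul, Mor.mk.injEq] at h
    obtain ⟨rfl, h0, h⟩ := h
    obtain ⟨y⟩ := y
    obtain ⟨y'⟩ := y'
    dsimp only at h0
    subst h0
    cases h
    obtain ⟨⟨δ⟩, hδ⟩ := (S.toPIso g).toEquiv.surjective ⟨γ⟩
    let k : ZSHom S x' x := ⟨δ, f ≫ eqToHom
      (congrArg (fun i : Into m => GObj.mk i.src) hδ.symm) ≫ Groupoid.inv (S.φ g ⟨δ⟩)⟩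
    refine ⟨⟨(k : x' ⟶ x)⟩, ?_⟩
    refine congrArg (fun e : ZSHom S x' ⟨y'⟩ => (Mor.mk (C := ZappaSzep S) (src := x') (tgt := ⟨y'⟩) e)) ?_
    refine ZSHom.ext' ?_ ?_
    · change _ = (⟨α⟩ : Into y').mul ((S.toPIso g).toEquiv ⟨δ⟩)
      rw [hδ]
    · change _ = (⟨(f ≫ eqToHom _ ≫ Groupoid.inv (S.φ g ⟨δ⟩)) ≫ S.φ g ⟨δ⟩⟩ : OutOf x'.obj)
      simp only [Category.assoc, Groupoid.inv_comp, Category.comp_id]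
      have key : ∀ (i : Into m) (j : Into m) (e : i = j) (f : (⟨x'.obj⟩ : GObj C) ⟶ ⟨i.src⟩)
          (e' : GObj.mk i.src = GObj.mk j.src),
          (⟨f⟩ : OutOf x'.obj) = ⟨f ≫ eqToHom e'⟩ := by
        rintro i j rfl f e'
        simp
      exact key ⟨γ⟩ _ hδ.symm f _

instance [FinitelyAligned C] : FinitelyAligned (ZappaSzep S) where
  exists_finite p q := by
    obtain ⟨Γ', hf, he⟩ := FinitelyAligned.exists_finite (ZSHom.fst p) (ZSHom.fst q)
    let lift : Mor C → Mor (ZappaSzep S) := fun ζ =>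
      ⟨((⟨ζ.hom, 𝟙 _⟩ : ZSHom S ⟨ζ.src⟩ ⟨ζ.tgt⟩) : (⟨ζ.src⟩ : ZappaSzep S) ⟶ ⟨ζ.tgt⟩)⟩
    refine ⟨lift '' Γ', hf.image lift, ?_⟩
    ext ε
    have h : (ZSHom.fst p ≤ ZSHom.fst ε ∧ ZSHom.fst q ≤ ZSHom.fst ε) ↔
        ∃ ζ ∈ Γ', ζ ≤ ZSHom.fst ε := by
      have := Set.ext_iff.1 he (ZSHom.fst ε)
      simpa only [Set.mem_ofPred_eq, Set.mem_iUnion, exists_prop] using this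
    simp only [Set.mem_ofPred_eq, Set.mem_iUnion, exists_prop, Set.exists_mem_image, ZSHom.le_iff]
    exact h

end System

end LCSC

open LCSC

/-! The equivalence of 1 and 2 holds for any finitely aligned left cancellative category in place of
the product, under the same alternative hypothesis. Near a point of its domain, an element of the
inverse semigroup is some `swap f g`, the map `fγ ↦ gγ`. If `fδ` meets `gδ` for all `δ`, this map
fixes every maximal set containing `f`, and by approximation every tight one
(`act_swap_eq_of_tight`). So its germs fill an open set of isotropy. Topological freeness makes them
units, that is, every tight set containing `f` contains some `fγ = gγ`. Compactness leaves finitely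
many such `γ`, and these are exhaustive.

Conversely, a germ in the interior of the isotropy at a maximal set is represented by a pair `f, g`
with `fδ` meeting `gδ` for all `δ`. A tight set containing `f` hits the exhaustive family provided
by 2, so the germ fixes a point and is a unit (`MeetingPairsAgree.germ_eq_unit`). Other tight sets
are limits of maximal ones, and the Hausdorff property carries the conclusion over; if all tight
sets are maximal, nothing is left to do.

For 2 and 3, the order on the Zappa-Szép product depends on first components only, so meeting and
exhaustiveness agree on both sides. The groupoid factor `d` of `(γ, d)` is invertible and cancels
(`pair_mul_eq_iff`). -/

namespace LCSC

/-! ### Maximal and tight sets: Zorn's lemma, ultrafilter limits, compactness. -/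

section Filters

variable {C : Type u} [Category.{v} C]

theorem principal_mem_hdSets (ε : Mor C) : {γ : Mor C | γ ≤ ε} ∈ hdSets C :=
  ⟨⟨ε, le_rfl' ε⟩, fun _ _ hβ h => le_trans' h hβ, fun _ _ hα hβ => ⟨ε, le_rfl' ε, hα, hβ⟩⟩

theorem exists_maximal_superset {F : Set (Mor C)} (hF : F ∈ hdSets C) :
    ∃ G ∈ maximalSets C, F ⊆ G := by
  obtain ⟨G, hFG, hG⟩ := zorn_subset_nonempty (hdSets C) (by
    rintro c hc hchain ⟨G₀, hG₀⟩
    refine ⟨⋃₀ c, ⟨?_, ?_, ?_⟩, fun s hs => Set.subset_sUnion_of_mem hs⟩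
    · obtain ⟨x, hx⟩ := (hc hG₀).1
      exact ⟨x, G₀, hG₀, hx⟩
    · rintro α β ⟨G, hG, hβ⟩ h
      exact ⟨G, hG, (hc hG).2.1 α β hβ h⟩
    · rintro α β ⟨G, hG, hα⟩ ⟨H, hH, hβ⟩
      rcases hchain.total hG hH with h | h
      · obtain ⟨γ, hγ, h'⟩ := (hc hH).2.2 α β (h hα) hβ
        exact ⟨γ, ⟨H, hH, hγ⟩, h'⟩
      · obtain ⟨γ, hγ, h'⟩ := (hc hG).2.2 α β hα (h hβ)
        exact ⟨γ, ⟨G, hG, hγ⟩, h'⟩) F hF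
  exact ⟨G, ⟨hG.prop, fun D hD h => (hG.eq_of_subset hD h).symm⟩, hFG⟩

theorem exists_maximal_mem (ε : Mor C) : ∃ G ∈ maximalSets C, ε ∈ G := by
  obtain ⟨G, hG, h⟩ := exists_maximal_superset (principal_mem_hdSets ε)
  exact ⟨G, hG, h (le_rfl' ε)⟩

/-- Elements of a directed set meet. -/
theorem meets_of_mem {F : Set (Mor C)} (hF : F ∈ hdSets C) {α β : Mor C} (hα : α ∈ F)
    (hβ : β ∈ F) : Meets α β := by
  obtain ⟨γ, -, h⟩ := hF.2.2 α β hα hβ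
  exact ⟨γ, h⟩

theorem maximalSets_subset_tightSets : maximalSets C ⊆ tightSets C :=
  fun F hF => ⟨hF.1, fun _ hα _ _ h => ⟨F, hF, hα, h⟩⟩

variable [FinitelyAligned C]

/-- The limit of hereditary directed sets along an ultrafilter is hereditary and directed. -/
theorem ultralimit_mem_hdSets (𝒰 : Ultrafilter (Set (Mor C))) (h : hdSets C ∈ 𝒰) {α : Mor C}
    (hα : {G : Set (Mor C) | α ∈ G} ∈ 𝒰) :
    {β : Mor C | {G : Set (Mor C) | β ∈ G} ∈ 𝒰} ∈ hdSets C := by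
  refine ⟨⟨α, hα⟩, ?_, ?_⟩
  · intro a b hb hab
    change {G : Set (Mor C) | a ∈ G} ∈ 𝒰
    filter_upwards [h, hb] with G hG hbG using hG.2.1 a b hbG hab
  · intro a b ha hb
    -- Almost every `G` contains an upper bound of `a` and `b`, hence one of the finitely many
    -- generators of their common extensions; the ultrafilter selects a single generator.
    obtain ⟨Γ, hΓ, he⟩ := FinitelyAligned.exists_finite a b
    have hU : (⋃ ζ ∈ Γ, {G : Set (Mor C) | ζ ∈ G}) ∈ 𝒰 := by
      filter_upwards [h, ha, hb] with G hG haG hbG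
      obtain ⟨ε, hε, h1⟩ := hG.2.2 a b haG hbG
      have h2 : ε ∈ {ε : Mor C | a ≤ ε ∧ b ≤ ε} := h1
      rw [he] at h2
      obtain ⟨ζ, hζ, hle⟩ := Set.mem_iUnion₂.1 h2
      exact Set.mem_biUnion hζ (hG.2.1 ζ ε hε hle)
    rw [Ultrafilter.finite_biUnion_mem_iff hΓ] at hU
    obtain ⟨ζ, hζ, hm⟩ := hU
    have h3 : ζ ∈ {ε : Mor C | a ≤ ε ∧ b ≤ ε} := by
      rw [he]
      exact Set.mem_biUnion hζ (le_rfl' ζ)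
    exact ⟨ζ, hm, h3⟩

/-- The limit of maximal sets along an ultrafilter is tight. -/
theorem ultralimit_mem_tightSets (𝒰 : Ultrafilter (Set (Mor C))) (h : maximalSets C ∈ 𝒰)
    {α : Mor C} (hα : {G : Set (Mor C) | α ∈ G} ∈ 𝒰) :
    {β : Mor C | {G : Set (Mor C) | β ∈ G} ∈ 𝒰} ∈ tightSets C := by
  refine ⟨ultralimit_mem_hdSets 𝒰 (Filter.mem_of_superset h fun _ hG => hG.1) hα, ?_⟩
  intro a ha Y hY hdis
  have h1 : (⋂ y ∈ Y, {G : Set (Mor C) | y ∈ G}ᶜ) ∈ 𝒰 := by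
    refine (Filter.biInter_mem hY).2 fun y hy => ?_
    refine Ultrafilter.compl_mem_iff_notMem.2 fun hy' => ?_
    exact Set.eq_empty_iff_forall_notMem.1 hdis y ⟨hy', hy⟩
  -- The required maximal set is any `G` in the large set of those that contain `a` and avoid the
  -- finite set `Y`.
  obtain ⟨G, ⟨hG, haG⟩, hGY⟩ := 𝒰.nonempty_of_mem (Filter.inter_mem (Filter.inter_mem h ha) h1)
  refine ⟨G, hG, haG, Set.eq_empty_iff_forall_notMem.2 ?_⟩
  rintro y ⟨hyG, hyY⟩
  exact Set.mem_iInter₂.1 hGY y hyY hyG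

/-- A maximal set contains every element that meets all of its elements. -/
theorem mem_of_forall_meets {F : Set (Mor C)} (hF : F ∈ maximalSets C) {α : Mor C}
    (h : ∀ β ∈ F, Meets α β) : α ∈ F := by
  -- These sets generate a proper filter, since `F` is directed and `α` meets each `β`. The limit
  -- along a finer ultrafilter contains both `F` and `α`, so it equals `F` by maximality.
  let A : F → Set (Set (Mor C)) := fun β => {G | G ∈ hdSets C ∧ α ∈ G ∧ β.1 ∈ G}
  have hne : Nonempty F := hF.1.1.to_subtype
  have hdir : Directed (· ≥ ·) fun β => Filter.principal (A β) := by
    rintro ⟨β, hβ⟩ ⟨γ, hγ⟩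
    obtain ⟨δ, hδ, h1, h2⟩ := hF.1.2.2 β γ hβ hγ
    exact ⟨⟨δ, hδ⟩, Filter.principal_mono.2 fun G hG => ⟨hG.1, hG.2.1, hG.1.2.1 _ _ hG.2.2 h1⟩,
      Filter.principal_mono.2 fun G hG => ⟨hG.1, hG.2.1, hG.1.2.1 _ _ hG.2.2 h2⟩⟩
  have hnb : (⨅ β, Filter.principal (A β)).NeBot := by
    refine Filter.iInf_neBot_of_directed' hdir fun β => Filter.principal_neBot_iff.2 ?_
    obtain ⟨ε, h1, h2⟩ := h β.1 β.2
    exact ⟨_, principal_mem_hdSets ε, h1, h2⟩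
  let 𝒰 := Ultrafilter.of (⨅ β, Filter.principal (A β))
  have hA : ∀ β, A β ∈ 𝒰 := fun β =>
    Ultrafilter.of_le _ (Filter.mem_iInf_of_mem β (Filter.mem_principal_self _))
  obtain ⟨β₀⟩ := hne
  have hα : {G : Set (Mor C) | α ∈ G} ∈ 𝒰 := Filter.mem_of_superset (hA β₀) fun _ hG => hG.2.1
  have hhd := ultralimit_mem_hdSets 𝒰 (Filter.mem_of_superset (hA β₀) fun _ hG => hG.1) hα
  have heq := hF.2 _ hhd fun β hβ => Filter.mem_of_superset (hA ⟨β, hβ⟩) fun _ hG => hG.2.2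
  rw [← heq]
  exact hα

/-- Every finite set disjoint from a maximal set `F` is avoided by all extensions of some element
of `F`. -/
theorem exists_mem_forall_not_meets {F : Set (Mor C)} (hF : F ∈ maximalSets C) {Y : Set (Mor C)}
    (hY : Y.Finite) (hdis : F ∩ Y = ∅) {α : Mor C} (hα : α ∈ F) :
    ∃ β ∈ F, α ≤ β ∧ ∀ y ∈ Y, ¬ Meets y β := by
  induction Y, hY using Set.Finite.induction_on with
  | empty => exact ⟨α, hα, le_rfl' α, by simp⟩
  | @insert y Y _ _ ih =>
    have hy : y ∉ F := fun h =>
      Set.eq_empty_iff_forall_notMem.1 hdis y ⟨h, Set.mem_insert _ _⟩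
    rw [Set.inter_insert_of_notMem hy] at hdis
    obtain ⟨β, hβ, hle, hmiss⟩ := ih hdis
    -- An element outside a maximal set fails to meet some member of it; an upper bound of that
    -- member and `β` then misses `y` as well.
    obtain ⟨γ, hγ, hyγ⟩ : ∃ γ ∈ F, ¬ Meets y γ := by
      by_contra! h
      exact hy (mem_of_forall_meets hF h)
    obtain ⟨δ, hδ, h1, h2⟩ := hF.1.2.2 β γ hβ hγ
    refine ⟨δ, hδ, le_trans' hle h1, ?_⟩
    rintro z (rfl | hz) ⟨ε, h3, h4⟩
    · exact hyγ ⟨ε, h3, le_trans' h2 h4⟩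
    · exact hmiss z hz ⟨ε, h3, le_trans' h1 h4⟩

/-- If the elements of `T` meet every tight set containing `α`, then so do finitely many
of them. -/
theorem exists_finite_of_forall_tight {α : Mor C} {T : Set (Mor C)}
    (h : ∀ F ∈ tightSets C, α ∈ F → ∃ β ∈ T, β ∈ F) :
    ∃ Y ⊆ T, Y.Finite ∧ ∀ F ∈ maximalSets C, α ∈ F → ∃ β ∈ Y, β ∈ F := by
  -- If every finite `Y` were avoided by a maximal set containing `α`, a limit of such sets as `Y`
  -- grows would be a tight set containing `α` and disjoint from `T`.
  by_contra! hcon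
  let I := {Y : Set (Mor C) // Y ⊆ T ∧ Y.Finite}
  let A : I → Set (Set (Mor C)) := fun Y => {G | G ∈ maximalSets C ∧ α ∈ G ∧ ∀ β ∈ Y.1, β ∉ G}
  have hne : Nonempty I := ⟨∅, Set.empty_subset _, Set.finite_empty⟩
  have hdir : Directed (· ≥ ·) fun Y => Filter.principal (A Y) := by
    intro Y Z
    exact ⟨⟨Y.1 ∪ Z.1, Set.union_subset Y.2.1 Z.2.1, Y.2.2.union Z.2.2⟩,
      Filter.principal_mono.2 fun G hG => ⟨hG.1, hG.2.1, fun β hβ => hG.2.2 β (Or.inl hβ)⟩,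
      Filter.principal_mono.2 fun G hG => ⟨hG.1, hG.2.1, fun β hβ => hG.2.2 β (Or.inr hβ)⟩⟩
  have hnb : (⨅ Y, Filter.principal (A Y)).NeBot := by
    refine Filter.iInf_neBot_of_directed' hdir fun Y => Filter.principal_neBot_iff.2 ?_
    obtain ⟨F, hF⟩ := hcon Y.1 Y.2.1 Y.2.2
    exact ⟨F, hF⟩
  let 𝒰 := Ultrafilter.of (⨅ Y, Filter.principal (A Y))
  have hA : ∀ Y, A Y ∈ 𝒰 := fun Y =>
    Ultrafilter.of_le _ (Filter.mem_iInf_of_mem Y (Filter.mem_principal_self _))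
  obtain ⟨Y₀⟩ := hne
  have hα : {G : Set (Mor C) | α ∈ G} ∈ 𝒰 := Filter.mem_of_superset (hA Y₀) fun _ hG => hG.2.1
  have ht := ultralimit_mem_tightSets 𝒰 (Filter.mem_of_superset (hA Y₀) fun _ hG => hG.1) hα
  obtain ⟨β, hβT, hβ⟩ := h _ ht hα
  obtain ⟨G, hG, hG'⟩ := 𝒰.nonempty_of_mem (Filter.inter_mem hβ
    (hA ⟨{β}, Set.singleton_subset_iff.2 hβT, Set.finite_singleton β⟩))
  exact hG'.2.2 β rfl hG

end Filters

/-! ### The partial bijections `fγ ↦ gγ` and the sets they fix. -/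

section Swap

variable {C : Type u} [Category.{v} C] [LeftCancellative C]

theorem Mor.mul_le_mul_iff {x y : C} (f : x ⟶ y) (β γ : Into x) :
    (Mor.mk f).mul β ≤ (Mor.mk f).mul γ ↔ β.toMor ≤ γ.toMor := by
  constructor
  · rintro ⟨δ, h⟩
    refine ⟨δ, ?_⟩
    have h' : (Mor.mk f).mul γ = (Mor.mk f).mul (β.mul δ) := by
      rw [h]
      simp [Mor.mul, Into.mul]
    exact congrArg Into.toMor (Mor.mul_injective (Mor.mk f) h')
  · rintro ⟨δ, h⟩
    have h' : γ = β.mul δ := Into.toMor_injective h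
    subst h'
    exact ⟨δ, by simp [Mor.mul, Into.mul]⟩

theorem Meets.of_mul {x y : C} {f : x ⟶ y} {β γ : Into x}
    (h : Meets ((Mor.mk f).mul β) ((Mor.mk f).mul γ)) : Meets β.toMor γ.toMor := by
  obtain ⟨ε, ⟨δ, rfl⟩, h2⟩ := h
  have e : ((Mor.mk f).mul β).mul δ = (Mor.mk f).mul (β.mul δ) := by simp [Mor.mul, Into.mul]
  rw [e, Mor.mul_le_mul_iff] at h2
  exact ⟨_, ⟨δ, rfl⟩, h2⟩

/-- The partial bijection `τ^g σ^f : fΛ → gΛ`, `fγ ↦ gγ`. -/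
noncomputable def swap {x y z : C} (f : x ⟶ y) (g : x ⟶ z) : Mor C ≃. Mor C :=
  (sigma (Mor.mk f)).trans (tau (Mor.mk g))

theorem inS_swap {x y z : C} (f : x ⟶ y) (g : x ⟶ z) : InS (swap f g) :=
  InS.mul (InS.tau _) (InS.sigma _)

theorem mem_swap {x y z : C} {f : x ⟶ y} {g : x ⟶ z} {a b : Mor C} :
    b ∈ swap f g a ↔ ∃ γ : Into x, a = (Mor.mk f).mul γ ∧ b = (Mor.mk g).mul γ := by
  constructor
  · intro h
    obtain ⟨c, h1, h2⟩ := (PEquiv.mem_trans _ _ _ _).1 h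
    obtain ⟨β, rfl, rfl⟩ := mem_tau.1 ((PEquiv.mem_iff_mem _).1 h1)
    obtain ⟨γ, h3, rfl⟩ := mem_tau.1 h2
    obtain rfl := Into.toMor_injective h3
    exact ⟨β, rfl, rfl⟩
  · rintro ⟨γ, rfl, rfl⟩
    exact (PEquiv.mem_trans _ _ _ _).2 ⟨γ.toMor,
      (PEquiv.mem_iff_mem _).2 (mem_tau.2 ⟨γ, rfl, rfl⟩), mem_tau.2 ⟨γ, rfl, rfl⟩⟩

theorem meetsDom_swap {x y z : C} {f : x ⟶ y} {g : x ⟶ z} {F : Set (Mor C)}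
    (h : Mor.mk f ∈ F) : MeetsDom (swap f g) F :=
  ⟨Mor.mk f, h, Mor.mk g, mem_swap.2 ⟨Into.one x, by simp [Mor.mul], by simp [Mor.mul]⟩⟩

theorem swap_symm {x y z : C} (f : x ⟶ y) (g : x ⟶ z) : (swap f g).symm = swap g f := by
  ext a b
  change b ∈ (swap f g).symm a ↔ b ∈ swap g f a
  rw [PEquiv.mem_iff_mem, mem_swap, mem_swap]
  simp only [and_comm]

/-- An element of `S_Λ` agrees near an element `a` of its domain with some `τ^g σ^f`. -/
theorem InS.eq_mk {s : Mor C ≃. Mor C} (hs : InS s) {a b : Mor C} (h : b ∈ s a) :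
    ∃ (x y z : C) (f : x ⟶ y) (g : x ⟶ z), a = Mor.mk f ∧ b = Mor.mk g ∧
      ∀ γ : Into x, (Mor.mk g).mul γ ∈ s ((Mor.mk f).mul γ) := by
  obtain ⟨f⟩ := a
  obtain ⟨g⟩ := b
  have e := hs.equivariant.1 _ _ h
  dsimp only at e
  subst e
  exact ⟨_, _, _, f, g, rfl, rfl, fun γ => hs.equivariant.2 f g γ.hom h⟩

variable [FinitelyAligned C]

/-- By maximality it suffices that `gγ` meets each `β ∈ F`. Some `fγδ ∈ F` lies above `β`, and a
common extension of `fγδ` and `gγδ` lies above both `β` and `gγ`. -/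
theorem act_swap_subset_of_maximal {x y z : C} {f : x ⟶ y} {g : x ⟶ z}
    (h : ∀ δ : Into x, Meets ((Mor.mk f).mul δ) ((Mor.mk g).mul δ)) {F : Set (Mor C)}
    (hF : F ∈ maximalSets C) : act (swap f g) F ⊆ F := by
  rintro p ⟨a, ha, b, hab, hle⟩
  obtain ⟨γ, rfl, rfl⟩ := mem_swap.1 hab
  refine hF.1.2.1 p _ (mem_of_forall_meets hF fun β hβ => ?_) hle
  obtain ⟨ε, hε, ⟨δ, rfl⟩, h2⟩ := hF.1.2.2 _ β ha hβ
  obtain ⟨ζ, h3, h4⟩ := h (γ.mul δ)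
  refine ⟨ζ, le_trans' ⟨δ, ?_⟩ h4, le_trans' h2 ?_⟩
  · simp [Mor.mul, Into.mul]
  · simpa [Mor.mul, Into.mul] using h3

/-- A point of the image outside `F` would also be avoided by a maximal set containing `a`, against
the maximal case. -/
theorem act_swap_subset_of_tight {x y z : C} {f : x ⟶ y} {g : x ⟶ z}
    (h : ∀ δ : Into x, Meets ((Mor.mk f).mul δ) ((Mor.mk g).mul δ)) {F : Set (Mor C)}
    (hF : F ∈ tightSets C) : act (swap f g) F ⊆ F := by
  rintro p ⟨a, ha, b, hab, hle⟩
  by_contra hp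
  obtain ⟨D, hD, haD, hpD⟩ := hF.2 a ha {p} (Set.finite_singleton p)
    (Set.inter_singleton_eq_empty.2 hp)
  refine Set.inter_singleton_eq_empty.1 hpD (act_swap_subset_of_maximal h hD ?_)
  exact ⟨a, haD, b, hab, hle⟩

theorem Meets.symm {C : Type u} [Category.{v} C] {α β : Mor C} : Meets α β → Meets β α :=
  fun ⟨ε, h, h'⟩ => ⟨ε, h', h⟩

/-- The hypothesis is symmetric in `f` and `g`. The reverse inclusion comes from applying the
inverse bijection to the image of `F`, which is again tight. -/
theorem act_swap_eq_of_tight {x y z : C} {f : x ⟶ y} {g : x ⟶ z}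
    (h : ∀ δ : Into x, Meets ((Mor.mk f).mul δ) ((Mor.mk g).mul δ)) {F : Set (Mor C)}
    (hF : F ∈ tightSets C) (hf : Mor.mk f ∈ F) : act (swap f g) F = F := by
  refine (act_swap_subset_of_tight h hF).antisymm ?_
  have hd := meetsDom_swap (g := g) hf
  have h1 := act_swap_subset_of_tight (fun δ => (h δ).symm) (act_tight (inS_swap f g) hF hd)
  rwa [← swap_symm, act_symm_act (inS_swap f g) hF.1 hd] at h1

/-- A tight set containing `f` meets `fY` for every finite exhaustive `Y`. -/
theorem exists_mem_of_isFE {x y : C} {f : x ⟶ y} {F : Set (Mor C)} (hF : F ∈ tightSets C)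
    (hf : Mor.mk f ∈ F) {Y : Set (Into x)} (hY : IsFE (Mor.mk (𝟙 x)) Y) :
    ∃ γ ∈ Y, (Mor.mk f).mul γ ∈ F := by
  by_contra! hcon
  -- Tightness moves the failure to a maximal set `D`. Some `fδ ∈ D` then meets no element of `fY`,
  -- whereas exhaustiveness makes `δ` meet a member of `Y`.
  obtain ⟨D, hD, hfD, hdis⟩ := hF.2 _ hf ((Mor.mk f).mul '' Y) (hY.1.image _) (by
    rw [Set.eq_empty_iff_forall_notMem]
    rintro _ ⟨h1, γ, hγ, rfl⟩
    exact hcon γ hγ h1)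
  obtain ⟨b, hb, ⟨δ, rfl⟩, hmiss⟩ := exists_mem_forall_not_meets hD (hY.1.image _) hdis hfD
  obtain ⟨γ, hγ, ε, ⟨η, rfl⟩, h2⟩ := hY.2 δ.toMor ⟨δ, by simp [Mor.mul]⟩
  refine hmiss _ ⟨γ, hγ, rfl⟩ ⟨(Mor.mk f).mul (γ.mul η), ⟨η, by simp [Mor.mul, Into.mul]⟩, ?_⟩
  exact (Mor.mul_le_mul_iff f δ (γ.mul η)).2 h2

end Swap

/-! ### Topology of the tight spectrum and of its groupoid of germs. -/

section Germs

variable {C : Type u} [Category.{v} C]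

theorem TightSpace.ext' {F G : TightSpace C} (h : F.carrier = G.carrier) : F = G := by
  cases F
  cases G
  cases h
  rfl

theorem TightSpace.isOpen_mem (α : Mor C) : IsOpen {F : TightSpace C | α ∈ F.carrier} :=
  TopologicalSpace.isOpen_generateFrom_of_mem ⟨α, Or.inl rfl⟩

/-- Basic neighbourhoods in `Λ_tight`. -/
theorem TightSpace.exists_basic_subset {U : Set (TightSpace C)} (hU : IsOpen U)
    {F : TightSpace C} (hF : F ∈ U) : ∃ α ∈ F.carrier, ∃ Y : Set (Mor C), Y.Finite ∧
      F.carrier ∩ Y = ∅ ∧ ∀ G : TightSpace C, α ∈ G.carrier → G.carrier ∩ Y = ∅ → G ∈ U := by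
  induction hU with
  | basic U hU =>
    obtain ⟨α, rfl | rfl⟩ := hU
    · exact ⟨α, hF, ∅, Set.finite_empty, by simp, fun G hG _ => hG⟩
    · obtain ⟨β, hβ⟩ := F.hd.1
      exact ⟨β, hβ, {α}, Set.finite_singleton α, Set.inter_singleton_eq_empty.2 hF,
        fun G _ hG => Set.inter_singleton_eq_empty.1 hG⟩
  | univ =>
    obtain ⟨β, hβ⟩ := F.hd.1
    exact ⟨β, hβ, ∅, Set.finite_empty, by simp, fun G _ _ => Set.mem_univ G⟩
  | inter U V _ _ ihU ihV =>
    obtain ⟨α, hα, Y, hY, hdY, hUY⟩ := ihU hF.1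
    obtain ⟨β, hβ, Z, hZ, hdZ, hVZ⟩ := ihV hF.2
    -- Directedness merges the two positive conditions into one; only the finite avoided sets
    -- accumulate.
    obtain ⟨γ, hγ, h1, h2⟩ := F.hd.2.2 α β hα hβ
    refine ⟨γ, hγ, Y ∪ Z, hY.union hZ, by rw [Set.inter_union_distrib_left, hdY, hdZ]; simp, ?_⟩
    intro G hG hdG
    rw [Set.inter_union_distrib_left, Set.union_empty_iff] at hdG
    exact ⟨hUY G (G.hd.2.1 _ _ hG h1) hdG.1, hVZ G (G.hd.2.1 _ _ hG h2) hdG.2⟩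
  | sUnion S _ ih =>
    obtain ⟨U, hU, hFU⟩ := hF
    obtain ⟨α, hα, Y, hY, hdY, h⟩ := ih U hU hFU
    exact ⟨α, hα, Y, hY, hdY, fun G hG hdG => ⟨U, hU, h G hG hdG⟩⟩

/-- Density of the maximal sets: this is the definition of tightness read on basic neighbourhoods.
-/
theorem TightSpace.exists_maximal_mem {U : Set (TightSpace C)} (hU : IsOpen U)
    {F : TightSpace C} (hF : F ∈ U) : ∃ G ∈ U, G.carrier ∈ maximalSets C := by
  obtain ⟨α, hα, Y, hY, hdY, h⟩ := TightSpace.exists_basic_subset hU hF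
  obtain ⟨D, hD, hαD, hDY⟩ := F.isTight.2 α hα Y hY hdY
  exact ⟨⟨D, maximalSets_subset_tightSets hD⟩, h _ hαD hDY, hD⟩

variable (C) in
/-- If `fδ ⋒ gδ` for every `δ`, then `fγ = gγ` for the members `γ` of an exhaustive set. -/
def MeetingPairsAgree : Prop :=
  ∀ {x y : C} (f g : x ⟶ y), (∀ δ : Into x, Meets ((Mor.mk f).mul δ) ((Mor.mk g).mul δ)) →
    ∃ F : Set (Into x), IsFE (Mor.mk (𝟙 x)) F ∧ ∀ γ ∈ F, (Mor.mk f).mul γ = (Mor.mk g).mul γ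

variable [LeftCancellative C]

/-- The germ of `s` at `F`, as an element of the tight groupoid. -/
abbrev GermRep.germ {F G : TightSpace C} (p : GermRep F G) : TightGroupoid C :=
  ⟨(Quotient.mk (germSetoid F G) p : F ⟶ G)⟩

theorem isOpen_Theta {s : Mor C ≃. Mor C} (hs : InS s) {U : Set (TightSpace C)} (hU : IsOpen U) :
    IsOpen (Theta s U) :=
  TopologicalSpace.isOpen_generateFrom_of_mem ⟨s, U, hs, hU, rfl⟩

/-- Two elements that agree at `a` agree everywhere above `a`, and the members of `F` above `a` are
cofinal in `F`. -/
theorem act_eq_of_mem {s t : Mor C ≃. Mor C} (hs : InS s) (ht : InS t) {F : Set (Mor C)}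
    (hF : F ∈ hdSets C) {a b : Mor C} (ha : a ∈ F) (hsa : b ∈ s a) (hta : b ∈ t a) :
    act s F = act t F := by
  have key : ∀ {s t : Mor C ≃. Mor C}, InS s → InS t → b ∈ s a → b ∈ t a →
      act s F ⊆ act t F := by
    rintro s t hs ht hsa hta p ⟨x, hx, y, hy, hle⟩
    obtain ⟨c, hc, h1, h2⟩ := hF.2.2 a x ha hx
    obtain ⟨e, hse, hte, -⟩ := hs.extend₂ ht hsa hta h1
    exact ⟨c, hc, e, hte, le_trans' hle (hs.extend_le hy hse h2)⟩
  exact (key hs ht hsa hta).antisymm (key ht hs hta hsa)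

/-- Equality of the ranges need not be required: agreement at one point of `F` forces it. -/
theorem GermRep.germ_eq_iff {F G F' G' : TightSpace C} (p : GermRep F G) (p' : GermRep F' G') :
    p.germ = p'.germ ↔ F = F' ∧ ∃ a ∈ F.carrier, ∃ b, b ∈ p.elt a ∧ b ∈ p'.elt a := by
  constructor
  · intro h
    simp only [GermRep.germ, Mor.mk.injEq] at h
    obtain ⟨rfl, rfl, h⟩ := h
    exact ⟨rfl, (GermRep.equiv_iff _ _).1 (Quotient.exact (eq_of_heq h))⟩
  · rintro ⟨rfl, a, ha, b, h, h'⟩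
    obtain rfl : G = G' := TightSpace.ext' (by
      rw [← p.act_eq, ← p'.act_eq, act_eq_of_mem p.inS p'.inS F.hd ha h h'])
    refine congrArg (fun f : F ⟶ G => (Mor.mk f : TightGroupoid C)) ?_
    exact Quotient.sound ((GermRep.equiv_iff _ _).2 ⟨a, ha, b, h, h'⟩)

theorem GermRep.germ_eq_unit_iff {F G H : TightSpace C} (p : GermRep F G) :
    p.germ = (⟨𝟙 H⟩ : TightGroupoid C) ↔ F = H ∧ ∃ a ∈ F.carrier, a ∈ p.elt a := by
  rw [show (⟨𝟙 H⟩ : TightGroupoid C) = (GermRep.one H).germ from rfl, GermRep.germ_eq_iff]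
  refine and_congr_right ?_
  rintro rfl
  constructor
  · rintro ⟨a, ha, b, h, h'⟩
    obtain ⟨rfl, -⟩ := mem_idemAt.1 h'
    exact ⟨_, ha, h⟩
  · rintro ⟨a, ha, h⟩
    obtain ⟨a', ha', hle, h'⟩ := GermRep.one_elt ha
    obtain ⟨c, hc, hc', -⟩ :=
      p.inS.extend₂ (inS_idemAt a) h (mem_idemAt.2 ⟨rfl, le_rfl' a⟩) hle
    obtain ⟨rfl, -⟩ := mem_idemAt.1 hc'
    exact ⟨_, ha', _, hc, h'⟩

/-- Basic neighbourhoods in the tight groupoid. -/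
theorem exists_Theta_subset {V : Set (TightGroupoid C)} (hV : IsOpen V) {F G : TightSpace C}
    (p : GermRep F G) (hp : p.germ ∈ V) :
    ∃ U : Set (TightSpace C), IsOpen U ∧ F ∈ U ∧ Theta p.elt U ⊆ V := by
  induction hV with
  | basic V hV =>
    obtain ⟨t, U, ht, hU, rfl⟩ := hV
    obtain ⟨F', G', q, hq, rfl, he⟩ := hp
    obtain ⟨rfl, a, ha, b, h, h'⟩ := (GermRep.germ_eq_iff p q).1 he
    -- On sets containing `a` the elements `p.elt` and `q.elt` agree at `a`, so they have the same
    -- germs there.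
    refine ⟨U ∩ {H | a ∈ H.carrier}, hU.inter (TightSpace.isOpen_mem a), ⟨hq, ha⟩, ?_⟩
    rintro _ ⟨H, K, r, hr, hre, rfl⟩
    have h1 : b ∈ r.elt a := by rwa [hre]
    let r' : GermRep H K := ⟨q.elt, q.inS, ⟨a, hr.2, b, h'⟩, by
      rw [← r.act_eq, act_eq_of_mem q.inS r.inS H.hd hr.2 h' h1]⟩
    exact ⟨H, K, r', hr.1, rfl, (GermRep.germ_eq_iff r r').2 ⟨rfl, a, hr.2, b, h1, h'⟩⟩
  | univ => exact ⟨Set.univ, isOpen_univ, Set.mem_univ _, Set.subset_univ _⟩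
  | inter V W _ _ ihV ihW =>
    obtain ⟨U, hU, hFU, h⟩ := ihV hp.1
    obtain ⟨U', hU', hFU', h'⟩ := ihW hp.2
    refine ⟨U ∩ U', hU.inter hU', ⟨hFU, hFU'⟩, ?_⟩
    rintro _ ⟨H, K, r, hr, hre, rfl⟩
    exact ⟨h ⟨H, K, r, hr.1, hre, rfl⟩, h' ⟨H, K, r, hr.2, hre, rfl⟩⟩
  | sUnion S _ ih =>
    obtain ⟨V, hV, hpV⟩ := hp
    obtain ⟨U, hU, hFU, h⟩ := ih V hV hpV
    exact ⟨U, hU, hFU, h.trans (Set.subset_sUnion_of_mem hV)⟩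

/-- The unit space lies in the interior of the isotropy bundle. -/
theorem units_subset_interior_isotropy :
    (Set.range fun F : TightSpace C => (⟨𝟙 F⟩ : TightGroupoid C)) ⊆
      interior {x : TightGroupoid C | x.src = x.tgt} := by
  rintro _ ⟨F, rfl⟩
  -- The neighbourhood consists of all germs of one idempotent, which fixes every set meeting its
  -- domain.
  refine mem_interior.2 ⟨Theta (GermRep.one F).elt Set.univ, ?_,
    isOpen_Theta (GermRep.one F).inS isOpen_univ, F, F, GermRep.one F, trivial, rfl, rfl⟩
  rintro _ ⟨H, K, r, -, hre, rfl⟩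
  refine TightSpace.ext' ?_
  obtain ⟨a, ha, b, hb⟩ := r.dom
  have hb' := hb
  rw [hre] at hb'
  obtain ⟨rfl, -⟩ := mem_idemAt.1 hb'
  exact (act_idem (inS_idemAt b) (isIdem_idemAt b) H.hd (meetsDom_idemAt ha)).symm.trans
    ((act_eq_of_mem (inS_idemAt b) r.inS H.hd ha (mem_idemAt.2 ⟨rfl, le_rfl' b⟩) hb).trans
      r.act_eq)

/-! ### Topological freeness and pairs with `fδ ⋒ gδ` for all `δ`. -/

variable [FinitelyAligned C]

theorem TightTopologicallyFree.meetingPairsAgree (h : TightTopologicallyFree C) :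
    MeetingPairsAgree C := by
  intro x y f g hfg
  have hs := inS_swap f g
  have hsub : Theta (swap f g) Set.univ ⊆
      Set.range fun F : TightSpace C => (⟨𝟙 F⟩ : TightGroupoid C) := by
    rw [← h]
    refine interior_maximal ?_ (isOpen_Theta hs isOpen_univ)
    rintro _ ⟨F, G, p, -, hp, rfl⟩
    refine TightSpace.ext' ?_
    obtain ⟨a, ha, b, hb⟩ := p.dom
    rw [hp] at hb
    obtain ⟨γ, rfl, rfl⟩ := mem_swap.1 hb
    have hf : Mor.mk f ∈ F.carrier := F.hd.2.1 _ _ ha ⟨γ, rfl⟩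
    have h1 := act_swap_eq_of_tight hfg F.isTight hf
    rw [← hp, p.act_eq] at h1
    exact h1.symm
  -- `T` is the set of fixed points of `swap f g`. Its germ at each tight set containing `f` is a
  -- unit, so each such set contains a fixed point.
  obtain ⟨Y, hYT, hY, hYm⟩ := exists_finite_of_forall_tight (α := Mor.mk f)
    (T := {a | ∃ γ : Into x, a = (Mor.mk f).mul γ ∧ a = (Mor.mk g).mul γ}) (by
      intro F hF hf
      have hact := act_swap_eq_of_tight hfg hF hf
      let p : GermRep (⟨F, hF⟩ : TightSpace C) ⟨F, hF⟩ :=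
        ⟨swap f g, hs, meetsDom_swap hf, hact⟩
      obtain ⟨H, hH⟩ := hsub ⟨_, _, p, trivial, rfl, rfl⟩
      obtain ⟨-, a, ha, h'⟩ := p.germ_eq_unit_iff.1 hH.symm
      exact ⟨a, mem_swap.1 h', ha⟩)
  -- For exhaustiveness, a maximal set containing `fγ` also contains some `fβ ∈ Y`; these two meet,
  -- and `f` cancels.
  refine ⟨(Mor.mk f).mul ⁻¹' Y, ⟨hY.preimage (Mor.mul_injective _).injOn, ?_⟩, ?_⟩
  · rintro _ ⟨γ, rfl⟩
    have e : (Mor.mk (𝟙 x)).mul γ = γ.toMor := by simp [Mor.mul]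
    rw [e]
    obtain ⟨G, hG, hγ⟩ := exists_maximal_mem ((Mor.mk f).mul γ)
    obtain ⟨b, hbY, hbG⟩ := hYm G hG (hG.1.2.1 _ _ hγ ⟨γ, rfl⟩)
    obtain ⟨β, rfl, -⟩ := hYT hbY
    exact ⟨β, hbY, (meets_of_mem hG.1 hbG hγ).of_mul⟩
  · intro γ hγ
    obtain ⟨β, h1, h2⟩ := hYT hγ
    rw [h2, Mor.mul_injective _ h1]

/-- Germs at maximal sets in the interior of the isotropy bundle are units. -/
theorem MeetingPairsAgree.germ_eq_unit (h : MeetingPairsAgree C) {F G : TightSpace C}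
    (p : GermRep F G) (hF : F.carrier ∈ maximalSets C)
    (hp : p.germ ∈ interior {x : TightGroupoid C | x.src = x.tgt}) :
    p.germ = (⟨𝟙 F⟩ : TightGroupoid C) := by
  obtain ⟨U, hU, hFU, hUs⟩ := exists_Theta_subset isOpen_interior p hp
  replace hUs := hUs.trans interior_subset
  obtain ⟨α, hα, Y, hY, hdY, hb⟩ := TightSpace.exists_basic_subset hU hFU
  -- Because `F` is maximal, avoiding `Y` can be replaced by containing `β`, so one element
  -- describes the neighbourhood.
  obtain ⟨β, hβ, hαβ, hmiss⟩ := exists_mem_forall_not_meets hF hY hdY hα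
  obtain ⟨a, ha, c, hc⟩ := p.dom
  obtain ⟨β', hβ', h1, h2⟩ := F.hd.2.2 β a hβ ha
  obtain ⟨c', hc', -⟩ := p.inS.extend hc h2
  -- all maximal sets containing `β'` are fixed by `p.elt`
  have hfix : ∀ H ∈ maximalSets C, β' ∈ H → act p.elt H = H := by
    intro H hH hβH
    have hHt := maximalSets_subset_tightSets hH
    have hd : MeetsDom p.elt H := ⟨β', hβH, c', hc'⟩
    let r : GermRep (⟨H, hHt⟩ : TightSpace C) ⟨act p.elt H, act_tight p.inS hHt hd⟩ :=
      ⟨p.elt, p.inS, hd, rfl⟩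
    have hm : (⟨H, hHt⟩ : TightSpace C) ∈ U := by
      refine hb _ (hH.1.2.1 _ _ hβH (le_trans' hαβ h1)) ?_
      rw [Set.eq_empty_iff_forall_notMem]
      rintro z ⟨hzH, hzY⟩
      obtain ⟨ε, h3, h4⟩ := meets_of_mem hH.1 hzH hβH
      exact hmiss z hzY ⟨ε, h3, le_trans' h1 h4⟩
    have hr : r.germ ∈ Theta p.elt U := ⟨_, _, r, hm, rfl, rfl⟩
    exact (congrArg TightSpace.carrier (hUs hr : _ = _)).symm
  obtain ⟨x, y, z, f, g, rfl, rfl, hfg⟩ := p.inS.eq_mk hc'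
  have hgF : Mor.mk g ∈ F.carrier := by
    rw [← hfix _ hF hβ']
    exact mem_act hβ' hc'
  -- Elements with a common extension have the same range.
  obtain rfl : y = z := by
    obtain ⟨_, -, ⟨_, rfl⟩, ⟨_, h3⟩⟩ := F.hd.2.2 _ _ hβ' hgF
    simp only [Mor.mul, Mor.mk.injEq] at h3
    exact h3.2.1
  -- A maximal set containing `fδ` contains `f`, so it is fixed by the action and contains `gδ` too;
  -- hence the two meet.
  obtain ⟨Z, hZ, hZe⟩ := h f g (by
    intro δ
    obtain ⟨H, hH, hδ⟩ := exists_maximal_mem ((Mor.mk f).mul δ)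
    refine meets_of_mem hH.1 hδ ?_
    rw [← hfix H hH (hH.1.2.1 _ _ hδ ⟨δ, rfl⟩)]
    exact mem_act hδ (hfg δ))
  obtain ⟨γ, hγ, hγF⟩ := exists_mem_of_isFE F.isTight hβ' hZ
  refine p.germ_eq_unit_iff.2 ⟨rfl, _, hγF, ?_⟩
  have h3 := hfg γ
  rwa [← hZe γ hγ] at h3

/-- In the Hausdorff case, a germ separated from the unit at its source is carried by the same
semigroup element to a nearby maximal set, where it is a unit; it then lies in both of the disjoint
neighbourhoods. -/
theorem MeetingPairsAgree.tightTopologicallyFree (h : MeetingPairsAgree C)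
    (hyp : T2Space (TightGroupoid C) ∨ tightSets C ⊆ maximalSets C) :
    TightTopologicallyFree C := by
  refine Set.Subset.antisymm ?_ units_subset_interior_isotropy
  rintro ⟨f⟩ hx
  rename_i F G
  induction f using Quotient.inductionOn with | _ p
  refine ⟨F, Eq.symm (?_ : p.germ = _)⟩
  rcases hyp with hT | hm
  · by_contra hne
    obtain ⟨V, W, hV, hW, hpV, h1W, hdis⟩ := t2_separation hne
    obtain ⟨U₁, hU₁, hF₁, hs₁⟩ := exists_Theta_subset (hV.inter isOpen_interior) p ⟨hpV, hx⟩
    obtain ⟨U₂, hU₂, hF₂, hs₂⟩ := exists_Theta_subset hW (GermRep.one F) h1W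
    obtain ⟨a, ha, b, hb⟩ := p.dom
    obtain ⟨c, hc, d, hd⟩ := (GermRep.one F).dom
    obtain ⟨H, ⟨⟨⟨hH₁, hH₂⟩, haH⟩, hcH⟩, hH⟩ := TightSpace.exists_maximal_mem
      (((hU₁.inter hU₂).inter (TightSpace.isOpen_mem a)).inter (TightSpace.isOpen_mem c))
      ⟨⟨⟨hF₁, hF₂⟩, ha⟩, hc⟩
    have hdH : MeetsDom p.elt H.carrier := ⟨a, haH, b, hb⟩
    have hdH' : MeetsDom (GermRep.one F).elt H.carrier := ⟨c, hcH, d, hd⟩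
    let r : GermRep H ⟨act p.elt H.carrier, act_tight p.inS H.isTight hdH⟩ :=
      ⟨p.elt, p.inS, hdH, rfl⟩
    -- The unit at `H` is represented by the idempotent used at `F`, so that its germ falls in the
    -- basic neighbourhood inside `W`.
    let e : GermRep H H := ⟨(GermRep.one F).elt, (GermRep.one F).inS, hdH',
      act_idem (GermRep.one F).inS (isIdem_idemAt _) H.hd hdH'⟩
    have hr := hs₁ ⟨H, _, r, hH₁, rfl, rfl⟩
    have he := hs₂ ⟨H, _, e, hH₂, rfl, rfl⟩
    have h1 := h.germ_eq_unit r hH hr.2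
    have h2 : e.germ = (⟨𝟙 H⟩ : TightGroupoid C) := e.germ_eq_unit_iff.2 ⟨rfl, c, hcH, by
      obtain ⟨rfl, -⟩ := mem_idemAt.1 hd
      exact hd⟩
    refine Set.disjoint_left.1 hdis hr.1 ?_
    change r.germ ∈ W
    rw [h1, ← h2]
    exact he
  · exact h.germ_eq_unit p (hm F.isTight) hx

end Germs

/-! ### Transfer along a surjection that preserves and reflects the order. -/

section OrderTransfer

variable {C : Type u} [Category.{v} C] {D : Type w} [Category.{q} D] {π : Mor D → Mor C}

/-- Elements with equal images lie below each other, so hereditary sets are saturated. This makes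
image and preimage mutually inverse on hereditary directed sets. -/
theorem preimage_image_of_hd (hπ : ∀ p q, p ≤ q ↔ π p ≤ π q) {F : Set (Mor D)}
    (hF : F ∈ hdSets D) : π ⁻¹' (π '' F) = F := by
  refine Set.Subset.antisymm ?_ (Set.subset_preimage_image π F)
  rintro p ⟨q, hq, h⟩
  exact hF.2.1 p q hq ((hπ p q).2 (h ▸ le_rfl' _))

theorem image_mem_hdSets (hπ : ∀ p q, p ≤ q ↔ π p ≤ π q) (hs : Function.Surjective π)
    {F : Set (Mor D)} (hF : F ∈ hdSets D) : π '' F ∈ hdSets C := by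
  refine ⟨hF.1.image π, ?_, ?_⟩
  · rintro α _ ⟨q, hq, rfl⟩ h
    obtain ⟨p, rfl⟩ := hs α
    exact ⟨p, hF.2.1 p q hq ((hπ p q).2 h), rfl⟩
  · rintro _ _ ⟨p, hp, rfl⟩ ⟨q, hq, rfl⟩
    obtain ⟨r, hr, h1, h2⟩ := hF.2.2 p q hp hq
    exact ⟨π r, ⟨r, hr, rfl⟩, (hπ _ _).1 h1, (hπ _ _).1 h2⟩

theorem preimage_mem_hdSets (hπ : ∀ p q, p ≤ q ↔ π p ≤ π q) (hs : Function.Surjective π)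
    {F : Set (Mor C)} (hF : F ∈ hdSets C) : π ⁻¹' F ∈ hdSets D := by
  refine ⟨hF.1.preimage hs, fun p q hq h => hF.2.1 _ _ hq ((hπ _ _).1 h), ?_⟩
  intro p q hp hq
  obtain ⟨γ, hγ, h1, h2⟩ := hF.2.2 _ _ hp hq
  obtain ⟨r, rfl⟩ := hs γ
  exact ⟨r, hγ, (hπ _ _).2 h1, (hπ _ _).2 h2⟩

theorem image_mem_maximalSets_iff (hπ : ∀ p q, p ≤ q ↔ π p ≤ π q) (hs : Function.Surjective π)
    {F : Set (Mor D)} (hF : F ∈ hdSets D) : π '' F ∈ maximalSets C ↔ F ∈ maximalSets D := by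
  constructor
  · refine fun h => ⟨hF, fun G hG hle => ?_⟩
    have h1 := h.2 _ (image_mem_hdSets hπ hs hG) (Set.image_mono hle)
    rw [← preimage_image_of_hd hπ hG, h1, preimage_image_of_hd hπ hF]
  · refine fun h => ⟨image_mem_hdSets hπ hs hF, fun G hG hle => ?_⟩
    have h1 := h.2 _ (preimage_mem_hdSets hπ hs hG) (Set.image_subset_iff.1 hle)
    rw [← h1, Set.image_preimage_eq G hs]

/-- The finite set to be avoided is lifted along a section of `π`; by saturation the choice of lifts
does not matter. -/
theorem image_mem_tightSets (hπ : ∀ p q, p ≤ q ↔ π p ≤ π q) (hs : Function.Surjective π)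
    {F : Set (Mor D)} (hF : F ∈ tightSets D) : π '' F ∈ tightSets C := by
  refine ⟨image_mem_hdSets hπ hs hF.1, ?_⟩
  rintro _ ⟨p, hp, rfl⟩ Y hY hdis
  obtain ⟨σ, hσ⟩ := hs.hasRightInverse
  obtain ⟨G, hG, hpG, hGY⟩ := hF.2 p hp (σ '' Y) (hY.image σ) (by
    rw [Set.eq_empty_iff_forall_notMem] at hdis ⊢
    rintro _ ⟨h, y, hy, rfl⟩
    exact hdis y ⟨⟨_, h, hσ y⟩, hy⟩)
  refine ⟨π '' G, (image_mem_maximalSets_iff hπ hs hG.1).2 hG, ⟨p, hpG, rfl⟩, ?_⟩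
  rw [Set.eq_empty_iff_forall_notMem] at hGY ⊢
  rintro y ⟨⟨q, hq, hqy⟩, hy⟩
  refine hGY (σ y) ⟨hG.1.2.1 _ q hq ((hπ _ _).2 ?_), y, hy, rfl⟩
  rw [hσ y, hqy]
  exact le_rfl' y

end OrderTransfer

/-! ### The Zappa-Szép product compared with `Λ` through first components. -/

section ZappaSzep

variable {C : Type u} [Category.{v} C] {Q : Type q} [Group Q] {Γ : Submonoid Q}
  {d : LengthFunction C Γ} [Groupoid.{w} (GObj C)] {S : CategorySystem d}

/-- The element `(α, s(α))` of `Λ ⋈^φ 𝒢`. -/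
def liftMor (S : CategorySystem d) (α : Mor C) : Mor (ZappaSzep S) :=
  ⟨((⟨α.hom, 𝟙 _⟩ : ZSHom S ⟨α.src⟩ ⟨α.tgt⟩) : (⟨α.src⟩ : ZappaSzep S) ⟶ ⟨α.tgt⟩)⟩

theorem fst_surjective : Function.Surjective (ZSHom.fst : Mor (ZappaSzep S) → Mor C) :=
  fun α => ⟨liftMor S α, rfl⟩

/-- The hypothesis on tight sets concerns `Λ`, whereas the groupoid is built from the product; this
bridges the two. -/
theorem tightSets_zappaSzep_subset (h : tightSets C = maximalSets C) :
    tightSets (ZappaSzep S) ⊆ maximalSets (ZappaSzep S) := by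
  intro F hF
  rw [← image_mem_maximalSets_iff ZSHom.le_iff fst_surjective hF.1, ← h]
  exact image_mem_tightSets ZSHom.le_iff fst_surjective hF

theorem meets_iff_fst (p q : Mor (ZappaSzep S)) :
    Meets p q ↔ Meets (ZSHom.fst p) (ZSHom.fst q) := by
  constructor
  · rintro ⟨ε, h1, h2⟩
    exact ⟨_, (ZSHom.le_iff _ _).1 h1, (ZSHom.le_iff _ _).1 h2⟩
  · rintro ⟨ε, h1, h2⟩
    obtain ⟨ε, rfl⟩ := fst_surjective (S := S) ε
    exact ⟨ε, (ZSHom.le_iff _ _).2 h1, (ZSHom.le_iff _ _).2 h2⟩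

/-- The element `(δ, s(δ))` of `v(Λ ⋈^φ 𝒢)`, for `δ ∈ vΛ`. -/
def Into.lift (S : CategorySystem d) {t : C} (δ : Into t) : Into (⟨t⟩ : ZappaSzep S) :=
  ⟨((⟨δ.hom, 𝟙 _⟩ : ZSHom S ⟨δ.src⟩ ⟨t⟩) : (⟨δ.src⟩ : ZappaSzep S) ⟶ ⟨t⟩)⟩

/-- The first component of an element of `v(Λ ⋈^φ 𝒢)`. -/
def Into.fst {t : ZappaSzep S} (δ : Into t) : Into t.obj := ⟨ZSHom.left δ.hom⟩

/-- The element `(α, a)` of `Λ ⋈^φ 𝒢`. -/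
def pair (S : CategorySystem d) {x z t : C} (α : x ⟶ z) (a : (⟨t⟩ : GObj C) ⟶ ⟨x⟩) :
    (⟨t⟩ : ZappaSzep S) ⟶ ⟨z⟩ := (⟨α, a⟩ : ZSHom S ⟨t⟩ ⟨z⟩)

/-- The second components are `φ(a, γ)d` and `φ(b, γ)d`, and `d` cancels because it is invertible.
-/
theorem pair_mul_eq_iff {x y z t : C} (α : x ⟶ z) (β : y ⟶ z) (a : (⟨t⟩ : GObj C) ⟶ ⟨x⟩)
    (b : (⟨t⟩ : GObj C) ⟶ ⟨y⟩) (γ : Into (⟨t⟩ : ZappaSzep S)) :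
    (Mor.mk (pair S α a)).mul γ = (Mor.mk (pair S β b)).mul γ ↔
      (Mor.mk α).mul (S.smul a γ.fst) = (Mor.mk β).mul (S.smul b γ.fst) ∧
        (⟨S.φ a γ.fst⟩ : OutOf γ.fst.src) = ⟨S.φ b γ.fst⟩ := by
  obtain ⟨γ⟩ := γ
  rename_i s
  obtain ⟨δ, k⟩ := γ
  constructor
  · intro h
    refine ⟨congrArg ZSHom.fst h, ?_⟩
    simp only [Mor.mk.injEq, heq_eq_eq, true_and] at h
    have h2 : OutOf.pre k ⟨S.φ a ⟨δ⟩⟩ = OutOf.pre k ⟨S.φ b ⟨δ⟩⟩ :=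
      congrArg (fun f : ZSHom S s ⟨z⟩ => (⟨f.right⟩ : OutOf s.obj)) h
    have h3 := congrArg (OutOf.pre (Groupoid.inv k)) h2
    change (⟨S.φ a ⟨δ⟩⟩ : OutOf _) = ⟨S.φ b ⟨δ⟩⟩
    simpa [OutOf.pre, ← Category.assoc] using h3
  · rintro ⟨h1, h2⟩
    refine congrArg (fun e : ZSHom S s ⟨z⟩ =>
      (Mor.mk (C := ZappaSzep S) (src := s) (tgt := ⟨z⟩) e)) ?_
    refine ZSHom.ext' ?_ ?_
    · exact Into.toMor_injective h1
    · exact congrArg (OutOf.pre k) h2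

theorem isFE_fst_image {t : C} {F : Set (Into (⟨t⟩ : ZappaSzep S))}
    (hF : IsFE (Mor.mk (𝟙 (⟨t⟩ : ZappaSzep S))) F) : IsFE (Mor.mk (𝟙 t)) (Into.fst '' F) := by
  refine ⟨hF.1.image _, ?_⟩
  rintro γ h
  obtain ⟨γ, rfl⟩ := fst_surjective (S := S) γ
  obtain ⟨β, hβ, hm⟩ := hF.2 γ ((ZSHom.le_iff _ _).2 h)
  exact ⟨β.fst, ⟨β, hβ, rfl⟩, (meets_iff_fst _ _).1 hm⟩

theorem isFE_lift_image {t : C} {F : Set (Into t)} (hF : IsFE (Mor.mk (𝟙 t)) F) :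
    IsFE (Mor.mk (𝟙 (⟨t⟩ : ZappaSzep S))) (Into.lift S '' F) := by
  refine ⟨hF.1.image _, fun γ h => ?_⟩
  obtain ⟨β, hβ, hm⟩ := hF.2 _ ((ZSHom.le_iff _ _).1 h)
  exact ⟨β.lift S, ⟨β, hβ, rfl⟩, (meets_iff_fst _ _).2 hm⟩

end ZappaSzep

end LCSC

/-! ### The equivalences for a category system. -/

theorem mainTheorem6 {C : Type u} [Category.{v} C] [LeftCancellative C] [FinitelyAligned C]
    {Q : Type q} [Group Q] (Γ : Submonoid Q) (hΓ : ∀ x ∈ Γ, x⁻¹ ∈ Γ → x = 1)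
    (d : LengthFunction C Γ) [Groupoid.{w} (GObj C)] (S : CategorySystem d)
    (hyp : T2Space (TightGroupoid (ZappaSzep S)) ∨ tightSets C = maximalSets C) :
    List.TFAE
      [ TightTopologicallyFree (ZappaSzep S),
        ∀ {x y : ZappaSzep S} (p p' : x ⟶ y),
          (∀ δ : Into x, Meets ((Mor.mk p).mul δ) ((Mor.mk p').mul δ)) →
          ∃ F : Set (Into x), IsFE (Mor.mk (𝟙 x)) F ∧
            ∀ γ ∈ F, (Mor.mk p).mul γ = (Mor.mk p').mul γ,
        ∀ {x y z t : C} (α : x ⟶ z) (β : y ⟶ z)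
          (a : (⟨t⟩ : GObj C) ⟶ ⟨x⟩) (b : (⟨t⟩ : GObj C) ⟶ ⟨y⟩),
          (∀ δ : Into t, Meets ((Mor.mk α).mul (S.smul a δ)) ((Mor.mk β).mul (S.smul b δ))) →
          ∃ F : Set (Into t), IsFE (Mor.mk (𝟙 t)) F ∧
            ∀ γ ∈ F, (Mor.mk α).mul (S.smul a γ) = (Mor.mk β).mul (S.smul b γ) ∧
              (⟨S.φ a γ⟩ : OutOf γ.src) = ⟨S.φ b γ⟩ ] := by
  -- Condition 2 unfolds from `MeetingPairsAgree` for the product category.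
  tfae_have 1 → 2 := fun h => h.meetingPairsAgree
  tfae_have 2 → 1 := fun h => MeetingPairsAgree.tightTopologicallyFree h
    (hyp.imp_right tightSets_zappaSzep_subset)
  tfae_have 2 → 3 := by
    intro h x y z t α β a b hm
    obtain ⟨F, hF, he⟩ := h (pair S α a) (pair S β b) fun δ => by
      rw [meets_iff_fst]
      exact hm δ.fst
    refine ⟨_, isFE_fst_image hF, ?_⟩
    rintro _ ⟨γ, hγ, rfl⟩
    exact (pair_mul_eq_iff α β a b γ).1 (he γ hγ)
  tfae_have 3 → 2 := by
    rintro h ⟨t⟩ ⟨z⟩ ⟨α, a⟩ ⟨β, b⟩ hm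
    -- Testing the meeting condition on the elements `(δ, s(δ))` is enough.
    obtain ⟨F, hF, he⟩ := h α β a b fun δ => (meets_iff_fst _ _).1 (hm (δ.lift S))
    refine ⟨_, isFE_lift_image hF, ?_⟩
    rintro _ ⟨γ, hγ, rfl⟩
    exact (pair_mul_eq_iff α β a b (γ.lift S)).2 (he γ hγ)
  tfae_finish
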